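/- Let $M$ be a compact (Hausdorff) smooth $n$-dimensional manifold without boundary and let $g$ be a smooth Riemannian metric on $M$. For a chart $x=(x^1,\dots,x^n):U\to\mathbb R^n$ of $M$, let $(x^1,\dots,x^n,y_1,\dots,y_n)$ be the induced chart of the cotangent bundle $\pi:T^*M\to M$ on $\pi^{-1}(U)$, in which a covector $v^*=\sum_i y_i\,dx^i$ over a point with coordinates $x$ has coordinates $(x,y)$. Put $g_{ij}=g(\partial/\partial x^i,\partial/\partial x^j)$, let $(g^{ij})$ be the inverse matrix of $(g_{ij})$, let $\Gamma^k_{ij}=\frac12\sum_l g^{kl}\left(\frac{\partial g_{jl}}{\partial x^i}+\frac{\partial g_{il}}{\partial x^j}-\frac{\partial g_{ij}}{\partial x^l}\right)$ be the Christoffel symbols of the Levi-Civita connection of $g$, and put $$X_i=\frac{\partial}{\partial x^i}+\sum_{k,s}\Gamma^k_{is}\,y_k\,\frac{\partial}{\partial y_s},\qquad i=1,\dots,n .$$ There is exactly one smooth Riemannian metric ${}^{S}g$ on the manifold $T^*M$ (the Sasakian metric of $g$) such that in every chart of $M$ $${}^{S}g(X_i,X_j)=g_{ij},\qquad {}^{S}g\Big(X_i,\frac{\partial}{\partial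 y_j}\Big)=0,\qquad {}^{S}g\Big(\frac{\partial}{\partial y_i},\frac{\partial}{\partial y_j}\Big)=g^{ij}\qquad\text{for all } i,j,$$ and ${}^{S}g$ is complete: every Cauchy sequence in $T^*M$ for the Riemannian distance of ${}^{S}g$ (the infimum of the lengths of $C^1$ paths joining two points, $+\infty$ if there is none) converges for this distance. -/

import Mathlib

open scoped Manifold ContDiff ENNReal Bundle

namespace SasakiCotangent

/-- The model space `ℝⁿ`. -/
abbrev Rn (n : ℕ) : Type := EuclideanSpace ℝ (Fin n)

/-- The cotangent bundle `T*M` of an `n`-manifold, as the total space of the bundle of continuous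
linear forms on the tangent spaces; it carries Mathlib's topology and smooth structure. -/
abbrev CotangentBundle (n : ℕ) (M : Type*) [TopologicalSpace M] [ChartedSpace (Rn n) M]
    [IsManifold (𝓡 n) ∞ M] : Type _ :=
  Bundle.TotalSpace (Rn n →L[ℝ] ℝ) (fun x : M ↦ TangentSpace (𝓡 n) x →L[ℝ] ℝ)

/-- The model with corners of `T*M`. -/
noncomputable abbrev cotangentModel (n : ℕ) :
    ModelWithCorners ℝ (Rn n × (Rn n →L[ℝ] ℝ)) (ModelProd (Rn n) (Rn n →L[ℝ] ℝ)) :=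
  (𝓡 n).prod 𝓘(ℝ, Rn n →L[ℝ] ℝ)

/-- Smooth Riemannian metrics on the `n`-manifold `M`. -/
abbrev RiemannianMetricOn (n : ℕ) (M : Type*) [TopologicalSpace M] [ChartedSpace (Rn n) M]
    [IsManifold (𝓡 n) ∞ M] : Type _ :=
  Bundle.ContMDiffRiemannianMetric (𝓡 n) ∞ (Rn n) (fun x : M ↦ TangentSpace (𝓡 n) x)

/-- Smooth Riemannian metrics on the manifold `T*M`. -/
abbrev CotangentRiemannianMetric (n : ℕ) (M : Type*) [TopologicalSpace M]
    [ChartedSpace (Rn n) M] [IsManifold (𝓡 n) ∞ M] : Type _ :=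
  Bundle.ContMDiffRiemannianMetric (cotangentModel n) ∞ (Rn n × (Rn n →L[ℝ] ℝ))
    (fun p : CotangentBundle n M ↦ TangentSpace (cotangentModel n) p)

noncomputable section

variable {n : ℕ} {M : Type*} [TopologicalSpace M] [ChartedSpace (Rn n) M]

/-! In what follows `φ = (x¹, …, xⁿ)` is a chart of `M`, `u` is a point of `φ.target ⊆ ℝⁿ`, and
the corresponding point of `M` is `φ.symm u`. -/

/-- The `i`-th standard basis vector of `ℝⁿ`. -/
def stdVec (i : Fin n) : Rn n := EuclideanSpace.single i (1 : ℝ)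

/-- The coordinate vector `∂/∂xⁱ` at `φ.symm u`. -/
def coordVec (φ : OpenPartialHomeomorph M (Rn n)) (u : Rn n) (i : Fin n) :
    TangentSpace (𝓡 n) (φ.symm u) :=
  mfderiv 𝓘(ℝ, Rn n) (𝓡 n) φ.symm u (stdVec i)

/-- The coordinate covector `dxⁱ` at `φ.symm u`. -/
def coordCovec (φ : OpenPartialHomeomorph M (Rn n)) (u : Rn n) (i : Fin n) :
    TangentSpace (𝓡 n) (φ.symm u) →L[ℝ] ℝ :=
  (EuclideanSpace.proj i : Rn n →L[ℝ] ℝ).comp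
    (mfderiv (𝓡 n) 𝓘(ℝ, Rn n) φ (φ.symm u))

variable [IsManifold (𝓡 n) ∞ M]

/-- The matrix of coefficients `g_{ij} = g(∂/∂xⁱ, ∂/∂xʲ)`, as a function of the coordinates. -/
def gCoeff (g : RiemannianMetricOn n M) (φ : OpenPartialHomeomorph M (Rn n)) (u : Rn n) :
    Matrix (Fin n) (Fin n) ℝ :=
  Matrix.of fun i j ↦ g.inner (φ.symm u) (coordVec φ u i) (coordVec φ u j)

/-- The coefficients `g^{ij}` of the inverse matrix. -/
def gInvCoeff (g : RiemannianMetricOn n M) (φ : OpenPartialHomeomorph M (Rn n)) (u : Rn n) :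
    Matrix (Fin n) (Fin n) ℝ :=
  (gCoeff g φ u)⁻¹

/-- The partial derivative `∂g_{ij}/∂xᵏ`. -/
def dgCoeff (g : RiemannianMetricOn n M) (φ : OpenPartialHomeomorph M (Rn n)) (u : Rn n)
    (k i j : Fin n) : ℝ :=
  fderiv ℝ (fun v : Rn n ↦ gCoeff g φ v i j) u (stdVec k)

/-- The Christoffel symbol `Γᵏ_{ij}` of the Levi-Civita connection of `g` in the chart `φ`. -/
def christoffel (g : RiemannianMetricOn n M) (φ : OpenPartialHomeomorph M (Rn n)) (u : Rn n)
    (k i j : Fin n) : ℝ :=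
  (1 / 2) * ∑ l, gInvCoeff g φ u k l *
    (dgCoeff g φ u i j l + dgCoeff g φ u j i l - dgCoeff g φ u l i j)

/-- The inverse of the local chart `(x¹, …, xⁿ, y₁, …, yₙ)` of `T*M` induced by `φ`: it sends
`(u, y)` to the covector `∑ i, yᵢ dxⁱ` at `φ.symm u`. -/
def cotParam (φ : OpenPartialHomeomorph M (Rn n)) (z : Rn n × Rn n) : CotangentBundle n M :=
  ⟨φ.symm z.1, ∑ i, z.2 i • coordCovec φ z.1 i⟩

/-- The coordinate vector `∂/∂xⁱ` of `T*M` at the point with coordinates `z = (u, y)`. -/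
def cotBaseVec (φ : OpenPartialHomeomorph M (Rn n)) (z : Rn n × Rn n) (i : Fin n) :
    TangentSpace (cotangentModel n) (cotParam φ z) :=
  mfderiv 𝓘(ℝ, Rn n × Rn n) (cotangentModel n) (cotParam φ) z
    ((stdVec i, 0) : Rn n × Rn n)

/-- The coordinate vector `∂/∂yᵢ` of `T*M` at the point with coordinates `z = (u, y)`. -/
def cotFibreVec (φ : OpenPartialHomeomorph M (Rn n)) (z : Rn n × Rn n) (i : Fin n) :
    TangentSpace (cotangentModel n) (cotParam φ z) :=
  mfderiv 𝓘(ℝ, Rn n × Rn n) (cotangentModel n) (cotParam φ) z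
    ((0, stdVec i) : Rn n × Rn n)

/-- The horizontal vector `Xᵢ = ∂/∂xⁱ + Γᵏ_{is} y_k ∂/∂y_s` at the point with coordinates
`z = (u, y)`. -/
def horVec (g : RiemannianMetricOn n M) (φ : OpenPartialHomeomorph M (Rn n))
    (z : Rn n × Rn n) (i : Fin n) : TangentSpace (cotangentModel n) (cotParam φ z) :=
  cotBaseVec φ z i +
    ∑ s, ∑ k, (christoffel g φ z.1 k i s * z.2 k) • cotFibreVec φ z s

/-- `G` is the Sasakian metric of `g`: in every chart `φ` of the smooth structure of `M` and at
every point of `T*M` over its domain, `G(Xᵢ, Xⱼ) = g_{ij}`, `G(Xᵢ, ∂/∂yⱼ) = 0` and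
`G(∂/∂yᵢ, ∂/∂yⱼ) = g^{ij}`. -/
def IsSasakianMetric (g : RiemannianMetricOn n M) (G : CotangentRiemannianMetric n M) : Prop :=
  ∀ φ ∈ IsManifold.maximalAtlas (𝓡 n) ∞ M, ∀ u ∈ φ.target, ∀ (y : Rn n) (i j : Fin n),
    G.inner (cotParam φ (u, y)) (horVec g φ (u, y) i) (horVec g φ (u, y) j)
        = gCoeff g φ u i j ∧
    G.inner (cotParam φ (u, y)) (horVec g φ (u, y) i) (cotFibreVec φ (u, y) j) = 0 ∧
    G.inner (cotParam φ (u, y)) (cotFibreVec φ (u, y) i) (cotFibreVec φ (u, y) j)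
        = gInvCoeff g φ u i j

/-- The distance of a Riemannian metric `G` on `T*M`: the infimum of the `G`-lengths of the `C¹`
paths between two points (`∞` if there is none). -/
def cotDist (G : CotangentRiemannianMetric n M) (p q : CotangentBundle n M) : ℝ≥0∞ :=
  letI : Bundle.RiemannianBundle
      (fun p : CotangentBundle n M ↦ TangentSpace (cotangentModel n) p) :=
    ⟨G.toRiemannianMetric⟩
  Manifold.riemannianEDist (cotangentModel n) p q

/-- The Riemannian metric `G` is complete: every Cauchy sequence for its distance converges. -/
def IsCompleteMetric (G : CotangentRiemannianMetric n M) : Prop :=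
  ∀ p : ℕ → CotangentBundle n M,
    (∀ ε : ℝ≥0∞, 0 < ε → ∃ N, ∀ k ≥ N, ∀ l ≥ N, cotDist G (p k) (p l) < ε) →
    ∃ q, Filter.Tendsto (fun k ↦ cotDist G (p k) q) Filter.atTop (nhds 0)

end

end SasakiCotangent

namespace SasakiCotangent

section LocalGeometry

set_option maxSynthPendingDepth 3

open ContinuousLinearMap Filter Topology

variable {E : Type*} [NormedAddCommGroup E] [NormedSpace ℝ E]

/-- A continuous bilinear form that is symmetric and positive definite. -/
structure IsMetricForm (B : E →L[ℝ] E →L[ℝ] ℝ) : Prop where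
  symm : ∀ v w, B v w = B w v
  pos : ∀ v, v ≠ 0 → 0 < B v v

namespace IsMetricForm

variable {B : E →L[ℝ] E →L[ℝ] ℝ}

lemma nonneg (h : IsMetricForm B) (v : E) : 0 ≤ B v v := by
  by_cases hv : v = 0
  · simp [hv]
  · exact (h.pos v hv).le

lemma apply_sq_le (h : IsMetricForm B) (v w : E) : B v w ^ 2 ≤ B v v * B w w := by
  let b : LinearMap.BilinForm ℝ E := LinearMap.mk₂ ℝ (fun x y ↦ B x y)
    (by simp) (by simp) (by simp) (by simp)
  exact b.apply_sq_le_of_symm h.nonneg ⟨fun x y ↦ h.symm x y⟩ v w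

lemma injective (h : IsMetricForm B) : Function.Injective B := by
  rw [injective_iff_map_eq_zero]
  intro v hv
  by_contra hne
  have := h.pos v hne
  simp [hv] at this

variable [FiniteDimensional ℝ E]

lemma isInvertible (h : IsMetricForm B) : B.IsInvertible := by
  have hd : Module.finrank ℝ E = Module.finrank ℝ (E →L[ℝ] ℝ) := by
    rw [← (LinearMap.toContinuousLinearMap (𝕜 := ℝ) (E := E) (F' := ℝ)).finrank_eq]
    exact (Subspace.dual_finrank_eq (K := ℝ) (V := E)).symm
  let e := (LinearMap.linearEquivOfInjective (B : E →ₗ[ℝ] (E →L[ℝ] ℝ)) h.injective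
    hd).toContinuousLinearEquiv
  exact ⟨e, by ext v w; rfl⟩

lemma apply_inverse (h : IsMetricForm B) (κ : E →L[ℝ] ℝ) : B (B.inverse κ) = κ :=
  congr($(h.isInvertible.self_comp_inverse) κ)

lemma inverse_eq_iff (h : IsMetricForm B) {κ : E →L[ℝ] ℝ} {v : E} :
    B.inverse κ = v ↔ ∀ w, κ w = B v w := by
  rw [h.isInvertible.inverse_apply_eq, ContinuousLinearMap.ext_iff]

lemma dual_symm (h : IsMetricForm B) (κ μ : E →L[ℝ] ℝ) :
    κ (B.inverse μ) = μ (B.inverse κ) := by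
  conv_lhs => rw [← h.apply_inverse κ]
  conv_rhs => rw [← h.apply_inverse μ]
  exact h.symm _ _

lemma dual_self (h : IsMetricForm B) (κ : E →L[ℝ] ℝ) :
    κ (B.inverse κ) = B (B.inverse κ) (B.inverse κ) := by rw [h.apply_inverse]

lemma dual_nonneg (h : IsMetricForm B) (κ : E →L[ℝ] ℝ) : 0 ≤ κ (B.inverse κ) := by
  rw [h.dual_self]; exact h.nonneg _

lemma dual_pos (h : IsMetricForm B) {κ : E →L[ℝ] ℝ} (hκ : κ ≠ 0) : 0 < κ (B.inverse κ) := by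
  rw [h.dual_self]
  refine h.pos _ fun h0 ↦ hκ ?_
  rw [← h.apply_inverse κ, h0, map_zero]

lemma dual_sq_le (h : IsMetricForm B) (κ μ : E →L[ℝ] ℝ) :
    κ (B.inverse μ) ^ 2 ≤ κ (B.inverse κ) * μ (B.inverse μ) := by
  have := h.apply_sq_le (B.inverse κ) (B.inverse μ)
  simpa only [h.apply_inverse] using this

lemma norm_sq_le (h : IsMetricForm B) (κ : E →L[ℝ] ℝ) : ‖κ‖ ^ 2 ≤ κ (B.inverse κ) * ‖B‖ := by
  have h0 : 0 ≤ κ (B.inverse κ) * ‖B‖ := mul_nonneg (h.dual_nonneg κ) (norm_nonneg _)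
  have : ‖κ‖ ≤ √(κ (B.inverse κ) * ‖B‖) := by
    refine κ.opNorm_le_bound (Real.sqrt_nonneg _) fun v ↦ ?_
    rw [← Real.sqrt_sq (norm_nonneg v), ← Real.sqrt_mul h0]
    refine Real.abs_le_sqrt ?_
    have h1 := h.apply_sq_le (B.inverse κ) v
    rw [← h.dual_self, h.apply_inverse] at h1
    have h2 : B v v ≤ ‖B‖ * ‖v‖ ^ 2 := by
      have := (le_abs_self _).trans (B.le_opNorm₂ v v)
      nlinarith
    calc κ v ^ 2 ≤ κ (B.inverse κ) * B v v := h1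
      _ ≤ κ (B.inverse κ) * (‖B‖ * ‖v‖ ^ 2) := mul_le_mul_of_nonneg_left h2 (h.dual_nonneg κ)
      _ = _ := by ring
  calc ‖κ‖ ^ 2 ≤ √(κ (B.inverse κ) * ‖B‖) ^ 2 := by gcongr
    _ = _ := Real.sq_sqrt h0

/-- Pulling back along an invertible map `A` transforms the inverse form accordingly. -/
lemma apply_inverse_bilinearComp (h : IsMetricForm B) {A : E →L[ℝ] E}
    (h' : IsMetricForm (B.bilinearComp A A)) (hA : Function.Surjective A) (κ : E →L[ℝ] ℝ) :
    A ((B.bilinearComp A A).inverse (κ ∘L A)) = B.inverse κ := by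
  symm
  rw [h.inverse_eq_iff]
  intro w
  obtain ⟨w, rfl⟩ := hA w
  have := congr($(h'.apply_inverse (κ ∘L A)) w)
  simpa using this.symm

end IsMetricForm

/-- The cyclic combination `(D a b c + D b a c - D c a b) / 2` of a trilinear form. -/
noncomputable def koszulForm (D : E →L[ℝ] E →L[ℝ] E →L[ℝ] ℝ) : E →L[ℝ] E →L[ℝ] E →L[ℝ] ℝ :=
  (1 / 2 : ℝ) • (D + D.flip -
    (ContinuousLinearMap.flipₗᵢ ℝ E E ℝ : (E →L[ℝ] E →L[ℝ] ℝ) →L[ℝ] _) ∘L D.flip)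

lemma koszulForm_apply (D : E →L[ℝ] E →L[ℝ] E →L[ℝ] ℝ) (a b c : E) :
    koszulForm D a b c = (1 / 2) * (D a b c + D b a c - D c a b) := by
  simp [koszulForm]

/-- The Christoffel map `(a, b) ↦ Γ(a, b)` of the metric with coefficients `B` at `u`. -/
noncomputable def christoffelMap (B : E → E →L[ℝ] E →L[ℝ] ℝ) (u : E) : E →L[ℝ] E →L[ℝ] E :=
  (compL ℝ E (E →L[ℝ] ℝ) E (B u).inverse) ∘L koszulForm (fderiv ℝ B u)

lemma christoffelMap_apply (B : E → E →L[ℝ] E →L[ℝ] ℝ) (u a b : E) :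
    christoffelMap B u a b = (B u).inverse (koszulForm (fderiv ℝ B u) a b) := rfl

/-- The vertical part `β - η ∘ Γ(a, ·)` of the vector `(a, β)` at the covector `(u, η)`. -/
noncomputable def connector (B : E → E →L[ℝ] E →L[ℝ] ℝ) (z : E × (E →L[ℝ] ℝ)) :
    (E × (E →L[ℝ] ℝ)) →L[ℝ] (E →L[ℝ] ℝ) :=
  snd ℝ E (E →L[ℝ] ℝ) - (compL ℝ E E ℝ z.2) ∘L christoffelMap B z.1 ∘L fst ℝ E (E →L[ℝ] ℝ)

lemma connector_apply (B : E → E →L[ℝ] E →L[ℝ] ℝ) (z v : E × (E →L[ℝ] ℝ)) :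
    connector B z v = v.2 - z.2 ∘L christoffelMap B z.1 v.1 := rfl

/-- The Sasakian metric in coordinates. -/
noncomputable def sasakiForm (B : E → E →L[ℝ] E →L[ℝ] ℝ) (z : E × (E →L[ℝ] ℝ)) :
    (E × (E →L[ℝ] ℝ)) →L[ℝ] (E × (E →L[ℝ] ℝ)) →L[ℝ] ℝ :=
  (B z.1).bilinearComp (fst ℝ E (E →L[ℝ] ℝ)) (fst ℝ E (E →L[ℝ] ℝ)) +
    (ContinuousLinearMap.apply ℝ ℝ ∘L (B z.1).inverse).bilinearComp (connector B z)
      (connector B z)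

lemma sasakiForm_apply (B : E → E →L[ℝ] E →L[ℝ] ℝ) (z v w : E × (E →L[ℝ] ℝ)) :
    sasakiForm B z v w =
      B z.1 v.1 w.1 + connector B z w ((B z.1).inverse (connector B z v)) := rfl

variable [FiniteDimensional ℝ E]

lemma isMetricForm_sasakiForm {B : E → E →L[ℝ] E →L[ℝ] ℝ} {z : E × (E →L[ℝ] ℝ)}
    (h : IsMetricForm (B z.1)) : IsMetricForm (sasakiForm B z) where
  symm v w := by
    rw [sasakiForm_apply, sasakiForm_apply, h.symm, h.dual_symm]
  pos v hv := by
    rw [sasakiForm_apply]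
    by_cases h1 : v.1 = 0
    · have h2 : v.2 ≠ 0 := fun h2 ↦ hv (Prod.ext h1 h2)
      have h3 : connector B z v = v.2 := by rw [connector_apply, h1]; ext; simp
      rw [h3, h1]
      simpa using h.dual_pos h2
    · exact add_pos_of_pos_of_nonneg (h.pos _ h1) (h.dual_nonneg _)

lemma contDiffOn_inverse {B : E → E →L[ℝ] E →L[ℝ] ℝ} {s : Set E}
    (hB : ContDiffOn ℝ ∞ B s) (h : ∀ u ∈ s, IsMetricForm (B u)) :
    ContDiffOn ℝ ∞ (fun u ↦ (B u).inverse) s := by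
  have := FiniteDimensional.complete ℝ E
  intro u hu
  obtain ⟨e, he⟩ := (h u hu).isInvertible
  have h1 := contDiffAt_map_inverse (n := ∞) e
  rw [he] at h1
  exact h1.comp_contDiffWithinAt u (hB u hu)

lemma contDiffOn_christoffelMap {B : E → E →L[ℝ] E →L[ℝ] ℝ} {s : Set E} (hs : IsOpen s)
    (hB : ContDiffOn ℝ ∞ B s) (h : ∀ u ∈ s, IsMetricForm (B u)) :
    ContDiffOn ℝ ∞ (christoffelMap B) s := by
  have hD : ContDiffOn ℝ ∞ (fderiv ℝ B) s := hB.fderiv_of_isOpen hs le_rfl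
  refine contDiffOn_clm_apply.2 fun a ↦ contDiffOn_clm_apply.2 fun b ↦ ?_
  simp only [christoffelMap_apply]
  refine (contDiffOn_inverse hB h).clm_apply (contDiffOn_clm_apply.2 fun c ↦ ?_)
  simp only [koszulForm_apply]
  have key : ∀ a b c : E, ContDiffOn ℝ ∞ (fun u ↦ fderiv ℝ B u a b c) s := fun a b c ↦
    ((hD.clm_apply contDiffOn_const).clm_apply contDiffOn_const).clm_apply contDiffOn_const
  exact contDiffOn_const.mul (((key a b c).add (key b a c)).sub (key c a b))

lemma contDiffOn_sasakiForm {B : E → E →L[ℝ] E →L[ℝ] ℝ} {s : Set E} (hs : IsOpen s)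
    (hB : ContDiffOn ℝ ∞ B s) (h : ∀ u ∈ s, IsMetricForm (B u)) :
    ContDiffOn ℝ ∞ (sasakiForm B) (s ×ˢ Set.univ) := by
  have hfst : ContDiffOn ℝ ∞ (Prod.fst : E × (E →L[ℝ] ℝ) → E) (s ×ˢ Set.univ) := contDiffOn_fst
  have hm : Set.MapsTo (Prod.fst : E × (E →L[ℝ] ℝ) → E) (s ×ˢ Set.univ) s := fun z hz ↦ hz.1
  have hc : ∀ v, ContDiffOn ℝ ∞ (fun z ↦ connector B z v) (s ×ˢ Set.univ) := fun v ↦ by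
    simp only [connector_apply]
    exact contDiffOn_const.sub (contDiffOn_snd.clm_comp
      (((contDiffOn_christoffelMap hs hB h).comp hfst hm).clm_apply contDiffOn_const))
  refine contDiffOn_clm_apply.2 fun v ↦ contDiffOn_clm_apply.2 fun w ↦ ?_
  simp only [sasakiForm_apply]
  exact (((hB.comp hfst hm).clm_apply contDiffOn_const).clm_apply contDiffOn_const).add
    ((hc w).clm_apply (((contDiffOn_inverse hB h).comp hfst hm).clm_apply (hc v)))

end LocalGeometry

section ChangeOfVariables

set_option maxSynthPendingDepth 3

open ContinuousLinearMap Filter Topology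

variable {E : Type*} [NormedAddCommGroup E] [NormedSpace ℝ E]

lemma fderiv_apply_apply {F : Type*} [NormedAddCommGroup F] [NormedSpace ℝ F]
    {B : F → E →L[ℝ] E →L[ℝ] ℝ} {u : F} (hB : DifferentiableAt ℝ B u) (a : F) (b c : E) :
    fderiv ℝ (fun w ↦ B w b c) u a = fderiv ℝ B u a b c := by
  have h := (hB.hasFDerivAt.clm_apply (hasFDerivAt_const b u)).clm_apply (hasFDerivAt_const c u)
  rw [h.fderiv]
  simp

lemma fderiv_bilinearComp_fderiv {B B' : E → E →L[ℝ] E →L[ℝ] ℝ} {σ : E → E} {u : E}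
    (hσ : ContDiffAt ℝ 2 σ u) (hB : DifferentiableAt ℝ B (σ u))
    (hB' : B' =ᶠ[𝓝 u] fun w ↦ (B (σ w)).bilinearComp (fderiv ℝ σ w) (fderiv ℝ σ w))
    (hB'd : DifferentiableAt ℝ B' u) (a b c : E) :
    fderiv ℝ B' u a b c =
      fderiv ℝ B (σ u) (fderiv ℝ σ u a) (fderiv ℝ σ u b) (fderiv ℝ σ u c) +
      B (σ u) (fderiv ℝ (fderiv ℝ σ) u a b) (fderiv ℝ σ u c) +
      B (σ u) (fderiv ℝ σ u b) (fderiv ℝ (fderiv ℝ σ) u a c) := by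
  have hσd : HasFDerivAt σ (fderiv ℝ σ u) u := (hσ.differentiableAt (by norm_num)).hasFDerivAt
  have hdσ : HasFDerivAt (fderiv ℝ σ) (fderiv ℝ (fderiv ℝ σ) u) u :=
    ((hσ.fderiv_right (m := 1) (by norm_num)).differentiableAt (by norm_num)).hasFDerivAt
  have h1 := ((hB.hasFDerivAt.comp u hσd).clm_apply
    (hdσ.clm_apply (hasFDerivAt_const b u))).clm_apply (hdσ.clm_apply (hasFDerivAt_const c u))
  have h2 : (fun w ↦ B' w b c) =ᶠ[𝓝 u]
      fun w ↦ (B ∘ σ) w (fderiv ℝ σ w b) (fderiv ℝ σ w c) := by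
    filter_upwards [hB'] with w hw
    rw [hw]; rfl
  rw [← fderiv_apply_apply hB'd, h2.fderiv_eq, h1.fderiv]
  simp
  ring

variable [FiniteDimensional ℝ E]

lemma fderiv_christoffelMap {B B' : E → E →L[ℝ] E →L[ℝ] ℝ} {σ : E → E} {u : E}
    (hσ : ContDiffAt ℝ 2 σ u) (hB : DifferentiableAt ℝ B (σ u))
    (hB' : B' =ᶠ[𝓝 u] fun w ↦ (B (σ w)).bilinearComp (fderiv ℝ σ w) (fderiv ℝ σ w))
    (hB'd : DifferentiableAt ℝ B' u) (hm : IsMetricForm (B (σ u))) (hm' : IsMetricForm (B' u))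
    (hs : Function.Surjective (fderiv ℝ σ u)) (a b : E) :
    fderiv ℝ σ u (christoffelMap B' u a b) =
      christoffelMap B (σ u) (fderiv ℝ σ u a) (fderiv ℝ σ u b) +
        fderiv ℝ (fderiv ℝ σ) u a b := by
  have hu := hB'.self_of_nhds
  have hsymm : ∀ x y, fderiv ℝ (fderiv ℝ σ) u x y = fderiv ℝ (fderiv ℝ σ) u y x :=
    fun x y ↦ (hσ.isSymmSndFDerivAt (by simp)) x y
  have hk : koszulForm (fderiv ℝ B' u) a b =
      (koszulForm (fderiv ℝ B (σ u)) (fderiv ℝ σ u a) (fderiv ℝ σ u b) +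
        B (σ u) (fderiv ℝ (fderiv ℝ σ) u a b)) ∘L fderiv ℝ σ u := by
    ext c
    rw [koszulForm_apply, fderiv_bilinearComp_fderiv hσ hB hB' hB'd,
      fderiv_bilinearComp_fderiv hσ hB hB' hB'd, fderiv_bilinearComp_fderiv hσ hB hB' hB'd,
      comp_apply, add_apply, koszulForm_apply, hsymm b a, hsymm c a, hsymm c b,
      hm.symm (fderiv ℝ σ u a) (fderiv ℝ (fderiv ℝ σ) u b c),
      hm.symm (fderiv ℝ σ u b) (fderiv ℝ (fderiv ℝ σ) u a c)]
    ring
  rw [hu] at hm'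
  rw [christoffelMap_apply, hk, hu, hm.apply_inverse_bilinearComp hm' hs, map_add,
    christoffelMap_apply, add_right_inj]
  rw [hm.inverse_eq_iff]
  exact fun _ ↦ rfl

/-- Naturality of the Sasakian metric under a change of coordinates of the base. -/
lemma sasakiForm_bilinearComp_fderiv {B B' : E → E →L[ℝ] E →L[ℝ] ℝ} {σ : E → E} {u : E}
    (hσ : ContDiffAt ℝ 2 σ u) (hB : DifferentiableAt ℝ B (σ u))
    (hB' : B' =ᶠ[𝓝 u] fun w ↦ (B (σ w)).bilinearComp (fderiv ℝ σ w) (fderiv ℝ σ w))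
    (hB'd : DifferentiableAt ℝ B' u) (hm : IsMetricForm (B (σ u))) (hm' : IsMetricForm (B' u))
    (hs : Function.Surjective (fderiv ℝ σ u)) (η : E →L[ℝ] ℝ) (a₁ a₂ : E)
    (β₁ β₂ : E →L[ℝ] ℝ) :
    sasakiForm B' (u, η ∘L fderiv ℝ σ u)
        (a₁, β₁ ∘L fderiv ℝ σ u + η ∘L fderiv ℝ (fderiv ℝ σ) u a₁)
        (a₂, β₂ ∘L fderiv ℝ σ u + η ∘L fderiv ℝ (fderiv ℝ σ) u a₂) =
      sasakiForm B (σ u, η) (fderiv ℝ σ u a₁, β₁) (fderiv ℝ σ u a₂, β₂) := by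
  have hc : ∀ a β, connector B' (u, η ∘L fderiv ℝ σ u)
      (a, β ∘L fderiv ℝ σ u + η ∘L fderiv ℝ (fderiv ℝ σ) u a) =
      connector B (σ u, η) (fderiv ℝ σ u a, β) ∘L fderiv ℝ σ u := by
    intro a β
    ext c
    simp [connector_apply, fderiv_christoffelMap hσ hB hB' hB'd hm hm' hs]
  have hu := hB'.self_of_nhds
  rw [hu] at hm'
  rw [sasakiForm_apply, sasakiForm_apply, hc, hc]
  simp only [hu, comp_apply, bilinearComp_apply]
  rw [hm.apply_inverse_bilinearComp hm' hs]

lemma hasFDerivAt_dual_self {B : E → E →L[ℝ] E →L[ℝ] ℝ} {s : Set E} (hs : IsOpen s)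
    (hB : ContDiffOn ℝ ∞ B s) (h : ∀ u ∈ s, IsMetricForm (B u))
    {z : E × (E →L[ℝ] ℝ)} (hz : z.1 ∈ s) :
    HasFDerivAt (fun w : E × (E →L[ℝ] ℝ) ↦ w.2 ((B w.1).inverse w.2))
      ((2 : ℝ) • (ContinuousLinearMap.apply ℝ ℝ ((B z.1).inverse z.2) ∘L connector B z)) z := by
  have hfst : HasFDerivAt (Prod.fst : E × (E →L[ℝ] ℝ) → E) (fst ℝ E (E →L[ℝ] ℝ)) z :=
    hasFDerivAt_fst
  have hsnd : HasFDerivAt (Prod.snd : E × (E →L[ℝ] ℝ) → E →L[ℝ] ℝ) (snd ℝ E (E →L[ℝ] ℝ)) z :=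
    hasFDerivAt_snd
  have hBd : HasFDerivAt B (fderiv ℝ B z.1) z.1 :=
    ((hB.contDiffAt (hs.mem_nhds hz)).differentiableAt (by simp)).hasFDerivAt
  have hId := (((contDiffOn_inverse hB h).contDiffAt (hs.mem_nhds hz)).differentiableAt
    (by simp)).hasFDerivAt
  obtain ⟨ξ', hξ⟩ : ∃ ξ', HasFDerivAt
      (fun w : E × (E →L[ℝ] ℝ) ↦ (B w.1).inverse w.2) ξ' z :=
    ⟨_, (hId.comp z hfst).clm_apply hsnd⟩
  have hF := hsnd.clm_apply hξ
  have hL := ((hBd.comp z hfst).clm_apply hξ).clm_apply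
    (hasFDerivAt_const ((B z.1).inverse z.2) z)
  have hR := hsnd.clm_apply (hasFDerivAt_const ((B z.1).inverse z.2) z)
  have hLR := hL.congr_of_eventuallyEq (f₁ := fun w ↦ w.2 ((B z.1).inverse z.2)) (by
    filter_upwards [hfst.continuousAt (hs.mem_nhds hz)] with w hw
    simp [(h w.1 hw).apply_inverse])
  have huniq := hLR.unique hR
  refine hF.congr_fderiv (ContinuousLinearMap.ext fun v ↦ ?_)
  have hv := congr($huniq v)
  have hm := h z.1 hz
  have h1 : B z.1 (ξ' v) ((B z.1).inverse z.2) = z.2 (ξ' v) := by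
    rw [hm.symm, hm.apply_inverse]
  have h2 : z.2 (christoffelMap B z.1 v.1 ((B z.1).inverse z.2)) =
      1 / 2 * fderiv ℝ B z.1 v.1 ((B z.1).inverse z.2) ((B z.1).inverse z.2) := by
    rw [christoffelMap_apply, hm.dual_symm, koszulForm_apply]
    ring
  simp [connector_apply, h1] at hv ⊢
  rw [h2]
  linarith

/-- The function `√(1 + |η|²)` has slope at most `1` for the Sasakian metric. -/
lemma fderiv_sqrt_one_add_dual_sq_le {B : E → E →L[ℝ] E →L[ℝ] ℝ} {s : Set E} (hs : IsOpen s)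
    (hB : ContDiffOn ℝ ∞ B s) (h : ∀ u ∈ s, IsMetricForm (B u))
    {z : E × (E →L[ℝ] ℝ)} (hz : z.1 ∈ s) (v : E × (E →L[ℝ] ℝ)) :
    (fderiv ℝ (fun w : E × (E →L[ℝ] ℝ) ↦ √(1 + w.2 ((B w.1).inverse w.2))) z v) ^ 2 ≤
      sasakiForm B z v v := by
  have hm := h z.1 hz
  have hF0 := hm.dual_nonneg z.2
  have hF := ((hasFDerivAt_dual_self hs hB h hz).const_add 1).sqrt (by positivity)
  rw [hF.fderiv]
  have h1 := hm.dual_sq_le (connector B z v) z.2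
  have h2 := hm.dual_nonneg (connector B z v)
  have h3 := hm.nonneg v.1
  have h4 : √(1 + z.2 ((B z.1).inverse z.2)) ^ 2 = 1 + z.2 ((B z.1).inverse z.2) :=
    Real.sq_sqrt (by positivity)
  have h5 : 0 < √(1 + z.2 ((B z.1).inverse z.2)) := Real.sqrt_pos.2 (by positivity)
  rw [sasakiForm_apply]
  simp only [smul_apply, comp_apply, apply_apply, smul_eq_mul]
  have h6 : (1 / (2 * √(1 + z.2 ((B z.1).inverse z.2))) *
      (2 * (connector B z v) ((B z.1).inverse z.2))) ^ 2 =
      (connector B z v) ((B z.1).inverse z.2) ^ 2 / (1 + z.2 ((B z.1).inverse z.2)) := by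
    rw [mul_pow, div_pow, mul_pow, h4]
    field_simp
  rw [h6, div_le_iff₀ (by positivity)]
  nlinarith [mul_nonneg h3 hF0]

end ChangeOfVariables

section Charts

set_option maxSynthPendingDepth 3

open ContinuousLinearMap Filter Topology Bundle

/-- The dual of the model space. -/
abbrev RnDual (n : ℕ) : Type := Rn n →L[ℝ] ℝ

variable {n : ℕ} {M : Type*} [TopologicalSpace M] [ChartedSpace (Rn n) M]

/-- The derivative of a chart, as an endomorphism of the model space. -/
noncomputable def dchart (φ : OpenPartialHomeomorph M (Rn n)) (x : M) : Rn n →L[ℝ] Rn n :=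
  mfderiv (𝓡 n) 𝓘(ℝ, Rn n) φ x

/-- The derivative of the inverse of a chart, as an endomorphism of the model space. -/
noncomputable def dsymm (φ : OpenPartialHomeomorph M (Rn n)) (u : Rn n) : Rn n →L[ℝ] Rn n :=
  mfderiv 𝓘(ℝ, Rn n) (𝓡 n) φ.symm u

variable {φ ψ : OpenPartialHomeomorph M (Rn n)}

lemma mdifferentiable_of_mem_maximalAtlas (hφ : φ ∈ IsManifold.maximalAtlas (𝓡 n) ∞ M) :
    φ.MDifferentiable (𝓡 n) 𝓘(ℝ, Rn n) :=
  ⟨(contMDiffOn_of_mem_maximalAtlas hφ).mdifferentiableOn (by simp),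
    (contMDiffOn_symm_of_mem_maximalAtlas hφ).mdifferentiableOn (by simp)⟩

lemma dsymm_comp_dchart (hφ : φ ∈ IsManifold.maximalAtlas (𝓡 n) ∞ M) {x : M}
    (hx : x ∈ φ.source) : dsymm φ (φ x) ∘L dchart φ x = ContinuousLinearMap.id ℝ (Rn n) :=
  (mdifferentiable_of_mem_maximalAtlas hφ).symm_comp_deriv hx

lemma dchart_comp_dsymm (hφ : φ ∈ IsManifold.maximalAtlas (𝓡 n) ∞ M) {u : Rn n}
    (hu : u ∈ φ.target) :
    dchart φ (φ.symm u) ∘L dsymm φ u = ContinuousLinearMap.id ℝ (Rn n) :=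
  (mdifferentiable_of_mem_maximalAtlas hφ).comp_symm_deriv hu

lemma dchart_comp_dsymm' (hφ : φ ∈ IsManifold.maximalAtlas (𝓡 n) ∞ M) {x : M}
    (hx : x ∈ φ.source) :
    dchart φ x ∘L dsymm φ (φ x) = ContinuousLinearMap.id ℝ (Rn n) := by
  have := dchart_comp_dsymm hφ (φ.map_source hx)
  rwa [φ.left_inv hx] at this

lemma contDiffAt_transition (hφ : φ ∈ IsManifold.maximalAtlas (𝓡 n) ∞ M)
    (hψ : ψ ∈ IsManifold.maximalAtlas (𝓡 n) ∞ M) {x : M} (hx : x ∈ φ.source)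
    (hx' : x ∈ ψ.source) : ContDiffAt ℝ ∞ (ψ ∘ φ.symm) (φ x) := by
  rw [← contMDiffAt_iff_contDiffAt]
  refine ContMDiffAt.comp (I' := 𝓡 n) (φ x) ?_
    (contMDiffAt_symm_of_mem_maximalAtlas hφ (φ.map_source hx))
  rw [φ.left_inv hx]
  exact contMDiffAt_of_mem_maximalAtlas hψ hx'

/-- The derivative of a change of charts. -/
lemma fderiv_transition (hφ : φ ∈ IsManifold.maximalAtlas (𝓡 n) ∞ M)
    (hψ : ψ ∈ IsManifold.maximalAtlas (𝓡 n) ∞ M) {x : M} (hx : x ∈ φ.source)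
    (hx' : x ∈ ψ.source) :
    fderiv ℝ (ψ ∘ φ.symm) (φ x) = dchart ψ x ∘L dsymm φ (φ x) := by
  rw [← mfderiv_eq_fderiv]
  have h := mfderiv_comp (I := 𝓘(ℝ, Rn n)) (I' := 𝓡 n) (I'' := 𝓘(ℝ, Rn n)) (φ x) (g := ψ)
    (f := φ.symm)
    (by rw [φ.left_inv hx]; exact (mdifferentiable_of_mem_maximalAtlas hψ).mdifferentiableAt hx')
    ((mdifferentiable_of_mem_maximalAtlas hφ).mdifferentiableAt_symm (φ.map_source hx))
  rw [h]
  have h2 : dchart ψ (φ.symm (φ x)) = dchart ψ x := by rw [φ.left_inv hx]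
  exact congr($h2 ∘L dsymm φ (φ x))

variable [IsManifold (𝓡 n) ∞ M]

lemma continuousLinearMapAt_trivializationAt_tangent (x₀ : M) {x : M}
    (hx : x ∈ (chartAt (Rn n) x₀).source) :
    (trivializationAt (Rn n) (TangentSpace (𝓡 n)) x₀).continuousLinearMapAt ℝ x =
      dchart (chartAt (Rn n) x₀) x :=
  TangentBundle.continuousLinearMapAt_trivializationAt hx

lemma symmL_trivializationAt_tangent (x₀ : M) {x : M}
    (hx : x ∈ (chartAt (Rn n) x₀).source) :
    (trivializationAt (Rn n) (TangentSpace (𝓡 n)) x₀).symmL ℝ x =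
      dsymm (chartAt (Rn n) x₀) (chartAt (Rn n) x₀ x) := by
  rw [TangentBundle.symmL_trivializationAt hx]
  have : Set.range (𝓡 n) = Set.univ := by simp
  rw [this, mfderivWithin_univ]
  rfl

lemma trivializationAt_tangent_apply (x₀ : M) {x : M}
    (hx : x ∈ (chartAt (Rn n) x₀).source) (v : TangentSpace (𝓡 n) x) :
    (trivializationAt (Rn n) (TangentSpace (𝓡 n)) x₀
      (TotalSpace.mk' (Rn n) (E := (TangentSpace (𝓡 n) : M → Type _)) x v)).2 =
      dchart (chartAt (Rn n) x₀) x v := by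
  refine Eq.trans ?_ congr($(continuousLinearMapAt_trivializationAt_tangent x₀ hx) v)
  rw [Trivialization.continuousLinearMapAt_apply, Trivialization.coe_linearMapAt_of_mem]
  exact hx

/-- The metric at a point, as a bilinear form on the model space. -/
noncomputable def metricAt (g : RiemannianMetricOn n M) (x : M) : Rn n →L[ℝ] Rn n →L[ℝ] ℝ :=
  g.inner x

/-- The coefficients of the metric in a chart, as a bilinear form. -/
noncomputable def metricCoord (g : RiemannianMetricOn n M) (φ : OpenPartialHomeomorph M (Rn n))
    (u : Rn n) : Rn n →L[ℝ] Rn n →L[ℝ] ℝ :=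
  (metricAt g (φ.symm u)).bilinearComp (dsymm φ u) (dsymm φ u)

lemma isMetricForm_metricCoord (g : RiemannianMetricOn n M)
    (hφ : φ ∈ IsManifold.maximalAtlas (𝓡 n) ∞ M) {u : Rn n} (hu : u ∈ φ.target) :
    IsMetricForm (metricCoord g φ u) where
  symm v w := g.symm (φ.symm u) _ _
  pos v hv := by
    refine g.pos (φ.symm u) (dsymm φ u v) fun h0 ↦ hv ?_
    have := congr($(dchart_comp_dsymm hφ hu) v)
    simpa [show dsymm φ u v = 0 from h0] using this.symm

lemma contDiffOn_metricCoord (g : RiemannianMetricOn n M)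
    (hφ : φ ∈ IsManifold.maximalAtlas (𝓡 n) ∞ M) :
    ContDiffOn ℝ ∞ (metricCoord g φ) φ.target := by
  refine contDiffOn_clm_apply.2 fun v ↦ contDiffOn_clm_apply.2 fun w ↦ fun u hu ↦ ?_
  refine ContDiffAt.contDiffWithinAt ?_
  rw [← contMDiffAt_iff_contDiffAt]
  have hsymm : ContMDiffAt 𝓘(ℝ, Rn n) (𝓡 n) ∞ φ.symm u :=
    contMDiffAt_symm_of_mem_maximalAtlas hφ hu
  have hvec : ∀ v : Rn n, ContMDiffAt 𝓘(ℝ, Rn n) ((𝓡 n).prod 𝓘(ℝ, Rn n)) ∞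
      (fun u' ↦ (TotalSpace.mk' (Rn n) (E := (TangentSpace (𝓡 n) : M → Type _)) (φ.symm u')
        (dsymm φ u' v))) u := by
    intro v
    refine contMDiffAt_totalSpace.2 ⟨hsymm, ?_⟩
    set ψ := chartAt (Rn n) (φ.symm u) with hψ
    have hψm : ψ ∈ IsManifold.maximalAtlas (𝓡 n) ∞ M := IsManifold.chart_mem_maximalAtlas _
    have hn : ∀ᶠ u' in 𝓝 u, u' ∈ φ.target ∧ φ.symm u' ∈ ψ.source :=
      inter_mem (φ.open_target.mem_nhds hu) ((φ.continuousAt_symm hu).preimage_mem_nhds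
        (ψ.open_source.mem_nhds (mem_chart_source _ _)))
    have hd : ContDiffAt ℝ ∞ (fun u' ↦ fderiv ℝ (ψ ∘ φ.symm) u' v) u := by
      have := contDiffAt_transition hφ hψm (φ.map_target hu) (mem_chart_source _ _)
      rw [φ.right_inv hu] at this
      exact (this.fderiv_right (m := ∞) (by simp)).clm_apply contDiffAt_const
    refine hd.contMDiffAt.congr_of_eventuallyEq ?_
    filter_upwards [hn] with u' hu'
    have := fderiv_transition hφ hψm (φ.map_target hu'.1) hu'.2
    rw [φ.right_inv hu'.1] at this
    rw [this]
    exact trivializationAt_tangent_apply (φ.symm u) hu'.2 (dsymm φ u' v)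
  have h1 : ContMDiffAt 𝓘(ℝ, Rn n) ((𝓡 n).prod 𝓘(ℝ, ℝ)) ∞
      (fun u' ↦ TotalSpace.mk' ℝ (E := Bundle.Trivial M ℝ) (φ.symm u')
        (g.inner (φ.symm u') (dsymm φ u' v) (dsymm φ u' w))) u := by
    apply ContMDiffAt.clm_bundle_apply₂ (F₁ := Rn n) (F₂ := Rn n)
    · exact ContMDiffAt.comp u g.contMDiff.contMDiffAt hsymm
    · exact hvec v
    · exact hvec w
  rw [contMDiffAt_totalSpace] at h1
  exact h1.2

/-- The transformation law of the metric coefficients. -/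
lemma metricCoord_transition (g : RiemannianMetricOn n M)
    (hφ : φ ∈ IsManifold.maximalAtlas (𝓡 n) ∞ M) (hψ : ψ ∈ IsManifold.maximalAtlas (𝓡 n) ∞ M)
    {x : M} (hx : x ∈ φ.source) (hx' : x ∈ ψ.source) :
    metricCoord g φ (φ x) = (metricCoord g ψ ((ψ ∘ φ.symm) (φ x))).bilinearComp
      (fderiv ℝ (ψ ∘ φ.symm) (φ x)) (fderiv ℝ (ψ ∘ φ.symm) (φ x)) := by
  have h1 : dsymm ψ (ψ x) ∘L fderiv ℝ (ψ ∘ φ.symm) (φ x) = dsymm φ (φ x) := by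
    rw [fderiv_transition hφ hψ hx hx', ← ContinuousLinearMap.comp_assoc,
      dsymm_comp_dchart hψ hx', ContinuousLinearMap.id_comp]
  have h2 : (ψ ∘ φ.symm) (φ x) = ψ x := by simp [φ.left_inv hx]
  have h3 : φ.symm (φ x) = ψ.symm (ψ x) := by rw [φ.left_inv hx, ψ.left_inv hx']
  rw [h2]
  ext v w
  rw [metricCoord, metricCoord, h3, ← h1]
  rfl

/-- The covector `p`, as a linear form on the model space. -/
def covecOf (p : CotangentBundle n M) : RnDual n := p.2

/-- The chart of `T*M` induced by the chart `φ` of `M`. -/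
noncomputable def cotChart (φ : OpenPartialHomeomorph M (Rn n)) (p : CotangentBundle n M) :
    Rn n × RnDual n :=
  (φ p.1, covecOf p ∘L dsymm φ (φ p.1))

/-- The inverse of the chart of `T*M` induced by the chart `φ` of `M`. -/
noncomputable def cotChartSymm (φ : OpenPartialHomeomorph M (Rn n)) (z : Rn n × RnDual n) :
    CotangentBundle n M :=
  ⟨φ.symm z.1, (z.2 ∘L dchart φ (φ.symm z.1) : RnDual n)⟩

lemma cotChartSymm_cotChart (hφ : φ ∈ IsManifold.maximalAtlas (𝓡 n) ∞ M)
    {p : CotangentBundle n M} (hp : p.1 ∈ φ.source) : cotChartSymm φ (cotChart φ p) = p := by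
  obtain ⟨x, η⟩ := p
  have h : ∀ y, y = x →
      (⟨y, ((covecOf (⟨x, η⟩ : CotangentBundle n M) ∘L dsymm φ (φ x)) ∘L dchart φ y : RnDual n)⟩ :
        CotangentBundle n M) = ⟨x, η⟩ := by
    rintro y rfl
    rw [ContinuousLinearMap.comp_assoc, dsymm_comp_dchart hφ hp, ContinuousLinearMap.comp_id]
    rfl
  exact h _ (φ.left_inv hp)

lemma cotChart_cotChartSymm (hφ : φ ∈ IsManifold.maximalAtlas (𝓡 n) ∞ M)
    {z : Rn n × RnDual n} (hz : z.1 ∈ φ.target) : cotChart φ (cotChartSymm φ z) = z := by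
  refine Prod.ext (φ.right_inv hz) ?_
  change (z.2 ∘L dchart φ (φ.symm z.1)) ∘L dsymm φ (φ (φ.symm z.1)) = z.2
  rw [φ.right_inv hz, ContinuousLinearMap.comp_assoc, dchart_comp_dsymm hφ hz,
    ContinuousLinearMap.comp_id]

lemma extChartAt_cotangent_apply (p₀ : CotangentBundle n M) {p : CotangentBundle n M}
    (hp : p.1 ∈ (chartAt (Rn n) p₀.1).source) :
    extChartAt (cotangentModel n) p₀ p = cotChart (chartAt (Rn n) p₀.1) p := by
  rw [FiberBundle.extChartAt]
  refine Prod.ext ?_ ?_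
  · rfl
  · refine Eq.trans (b := (trivializationAt (RnDual n)
      (fun x : M ↦ TangentSpace (𝓡 n) x →L[ℝ] ℝ) p₀.proj p).2) rfl ?_
    rw [hom_trivializationAt_apply]
    refine ContinuousLinearMap.ext fun v ↦ ?_
    simp only [ContinuousLinearMap.inCoordinates]
    rw [symmL_trivializationAt_tangent p₀.1 hp]
    simp
    rfl

lemma extChartAt_cotangent_source (p₀ : CotangentBundle n M) :
    (extChartAt (cotangentModel n) p₀).source =
      {p | p.1 ∈ (chartAt (Rn n) p₀.1).source} := by
  rw [FiberBundle.extChartAt]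
  ext p
  simp only [mfld_simps]
  exact ⟨fun h ↦ h.1.1, fun h ↦ ⟨⟨h, Set.mem_univ _⟩, h⟩⟩

lemma extChartAt_cotangent_target (p₀ : CotangentBundle n M) :
    (extChartAt (cotangentModel n) p₀).target =
      (chartAt (Rn n) p₀.1).target ×ˢ Set.univ := by
  rw [FiberBundle.extChartAt_target]
  ext z
  simp
  exact fun h ↦ (chartAt (Rn n) p₀.1).map_target h

lemma extChartAt_cotangent_symm_apply (p₀ : CotangentBundle n M) {z : Rn n × RnDual n}
    (hz : z.1 ∈ (chartAt (Rn n) p₀.1).target) :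
    (extChartAt (cotangentModel n) p₀).symm z = cotChartSymm (chartAt (Rn n) p₀.1) z := by
  have hφ : chartAt (Rn n) p₀.1 ∈ IsManifold.maximalAtlas (𝓡 n) ∞ M :=
    IsManifold.chart_mem_maximalAtlas _
  have h1 : (cotChartSymm (chartAt (Rn n) p₀.1) z).1 ∈ (chartAt (Rn n) p₀.1).source :=
    (chartAt (Rn n) p₀.1).map_target hz
  rw [← (extChartAt (cotangentModel n) p₀).left_inv (x := cotChartSymm (chartAt (Rn n) p₀.1) z)
    (by rw [extChartAt_cotangent_source]; exact h1), extChartAt_cotangent_apply p₀ h1,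
    cotChart_cotChartSymm hφ hz]

end Charts

section CotangentCharts

set_option maxSynthPendingDepth 3

open ContinuousLinearMap Filter Topology Bundle

variable {n : ℕ} {M : Type*} [TopologicalSpace M] [ChartedSpace (Rn n) M]
variable {φ ψ : OpenPartialHomeomorph M (Rn n)}

/-- The change of charts of `T*M` induced by a change of charts of `M`. -/
noncomputable def cotTransition (φ ψ : OpenPartialHomeomorph M (Rn n)) (z : Rn n × RnDual n) :
    Rn n × RnDual n :=
  ((ψ ∘ φ.symm) z.1, z.2 ∘L fderiv ℝ (φ ∘ ψ.symm) ((ψ ∘ φ.symm) z.1))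

lemma contDiffAt_cotTransition (hφ : φ ∈ IsManifold.maximalAtlas (𝓡 n) ∞ M)
    (hψ : ψ ∈ IsManifold.maximalAtlas (𝓡 n) ∞ M) {x : M} (hx : x ∈ φ.source)
    (hx' : x ∈ ψ.source) (η : RnDual n) : ContDiffAt ℝ ∞ (cotTransition φ ψ) (φ x, η) := by
  have h1 : ContDiffAt ℝ ∞ (fun z : Rn n × RnDual n ↦ (ψ ∘ φ.symm) z.1) (φ x, η) :=
    ContDiffAt.comp (φ x, η) (f := Prod.fst) (contDiffAt_transition hφ hψ hx hx') contDiffAt_fst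
  have h2 : ContDiffAt ℝ ∞ (fderiv ℝ (φ ∘ ψ.symm)) ((ψ ∘ φ.symm) (φ x)) := by
    have := contDiffAt_transition hψ hφ hx' hx
    rw [show (ψ ∘ φ.symm) (φ x) = ψ x by simp [φ.left_inv hx]]
    exact this.fderiv_right (m := ∞) (by simp)
  exact h1.prodMk (contDiffAt_snd.clm_comp (ContDiffAt.comp (φ x, η) h2 h1))

lemma fderiv_cotTransition (hφ : φ ∈ IsManifold.maximalAtlas (𝓡 n) ∞ M)
    (hψ : ψ ∈ IsManifold.maximalAtlas (𝓡 n) ∞ M) {x : M} (hx : x ∈ φ.source)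
    (hx' : x ∈ ψ.source) (η : RnDual n) (v : Rn n × RnDual n) :
    fderiv ℝ (cotTransition φ ψ) (φ x, η) v =
      (fderiv ℝ (ψ ∘ φ.symm) (φ x) v.1,
        v.2 ∘L fderiv ℝ (φ ∘ ψ.symm) (ψ x) + η ∘L fderiv ℝ (fderiv ℝ (φ ∘ ψ.symm)) (ψ x)
          (fderiv ℝ (ψ ∘ φ.symm) (φ x) v.1)) := by
  have hτ : (ψ ∘ φ.symm) (φ x) = ψ x := by simp [φ.left_inv hx]
  have h1 : HasFDerivAt (ψ ∘ φ.symm) (fderiv ℝ (ψ ∘ φ.symm) (φ x)) (φ x) :=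
    ((contDiffAt_transition hφ hψ hx hx').differentiableAt (by simp)).hasFDerivAt
  have h2 : HasFDerivAt (fderiv ℝ (φ ∘ ψ.symm)) (fderiv ℝ (fderiv ℝ (φ ∘ ψ.symm)) (ψ x))
      ((ψ ∘ φ.symm) (φ x)) := by
    rw [hτ]
    exact (((contDiffAt_transition hψ hφ hx' hx).fderiv_right (m := ∞)
      (by simp)).differentiableAt (by simp)).hasFDerivAt
  have h3 : HasFDerivAt (fun z : Rn n × RnDual n ↦ (ψ ∘ φ.symm) z.1)
      (fderiv ℝ (ψ ∘ φ.symm) (φ x) ∘L fst ℝ (Rn n) (RnDual n)) (φ x, η) :=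
    HasFDerivAt.comp (φ x, η) (f := Prod.fst) h1 hasFDerivAt_fst
  have h4 : HasFDerivAt (fun z : Rn n × RnDual n ↦ fderiv ℝ (φ ∘ ψ.symm) ((ψ ∘ φ.symm) z.1))
      (fderiv ℝ (fderiv ℝ (φ ∘ ψ.symm)) (ψ x) ∘L
        fderiv ℝ (ψ ∘ φ.symm) (φ x) ∘L fst ℝ (Rn n) (RnDual n)) (φ x, η) :=
    HasFDerivAt.comp (φ x, η) h2 h3
  have h5 : HasFDerivAt (fun z : Rn n × RnDual n ↦ z.2) (snd ℝ (Rn n) (RnDual n)) (φ x, η) :=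
    hasFDerivAt_snd
  have h6 : HasFDerivAt (cotTransition φ ψ) _ (φ x, η) := h3.prodMk (h5.clm_comp h4)
  rw [h6.fderiv]
  refine Prod.ext rfl ?_
  ext w
  simp [φ.left_inv hx]
  ring

variable [IsManifold (𝓡 n) ∞ M]

lemma cotTransition_cotChart (hφ : φ ∈ IsManifold.maximalAtlas (𝓡 n) ∞ M)
    (hψ : ψ ∈ IsManifold.maximalAtlas (𝓡 n) ∞ M) {p : CotangentBundle n M}
    (hp : p.1 ∈ φ.source) (hp' : p.1 ∈ ψ.source) :
    cotTransition φ ψ (cotChart φ p) = cotChart ψ p := by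
  have hτ : (ψ ∘ φ.symm) (φ p.1) = ψ p.1 := by simp [φ.left_inv hp]
  have key : ∀ η : RnDual n, (η ∘L dsymm φ (φ p.1)) ∘L
      fderiv ℝ (φ ∘ ψ.symm) ((ψ ∘ φ.symm) (φ p.1)) = η ∘L dsymm ψ (ψ p.1) := by
    intro η
    rw [hτ, fderiv_transition hψ hφ hp' hp, ← ContinuousLinearMap.comp_assoc,
      ContinuousLinearMap.comp_assoc η, dsymm_comp_dchart hφ hp, ContinuousLinearMap.comp_id]
  exact Prod.ext hτ (key p.2)

lemma eventually_proj_mem {U : Set M} (hU : IsOpen U) {p : CotangentBundle n M}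
    (hp : p.1 ∈ U) : ∀ᶠ q in 𝓝 p, q.1 ∈ U :=
  (FiberBundle.continuous_proj (RnDual n)
    (fun x : M ↦ TangentSpace (𝓡 n) x →L[ℝ] ℝ)).continuousAt.preimage_mem_nhds (hU.mem_nhds hp)

lemma contMDiffAt_cotChart (hφ : φ ∈ IsManifold.maximalAtlas (𝓡 n) ∞ M)
    {p : CotangentBundle n M} (hp : p.1 ∈ φ.source) :
    ContMDiffAt (cotangentModel n) 𝓘(ℝ, Rn n × RnDual n) ∞ (cotChart φ) p := by
  set ψ := chartAt (Rn n) p.1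
  have hψ : ψ ∈ IsManifold.maximalAtlas (𝓡 n) ∞ M := IsManifold.chart_mem_maximalAtlas _
  have hpψ : p.1 ∈ ψ.source := mem_chart_source _ _
  have h1 : ContMDiffAt (cotangentModel n) 𝓘(ℝ, Rn n × RnDual n) ∞
      (extChartAt (cotangentModel n) p) p := contMDiffAt_extChartAt
  have h2 : ContDiffAt ℝ ∞ (cotTransition ψ φ) (extChartAt (cotangentModel n) p p) := by
    rw [extChartAt_cotangent_apply p hpψ]
    exact contDiffAt_cotTransition hψ hφ hpψ hp _
  refine (h2.contMDiffAt.comp p h1).congr_of_eventuallyEq ?_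
  filter_upwards [eventually_proj_mem φ.open_source hp,
    eventually_proj_mem ψ.open_source hpψ] with q hq hq'
  rw [Function.comp_apply, extChartAt_cotangent_apply p hq', cotTransition_cotChart hψ hφ hq' hq]

lemma contMDiffAt_cotChartSymm (hφ : φ ∈ IsManifold.maximalAtlas (𝓡 n) ∞ M)
    {z : Rn n × RnDual n} (hz : z.1 ∈ φ.target) :
    ContMDiffAt 𝓘(ℝ, Rn n × RnDual n) (cotangentModel n) ∞ (cotChartSymm φ) z := by
  set p := cotChartSymm φ z with hpz
  set ψ := chartAt (Rn n) p.1
  have hψ : ψ ∈ IsManifold.maximalAtlas (𝓡 n) ∞ M := IsManifold.chart_mem_maximalAtlas _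
  have hpψ : p.1 ∈ ψ.source := mem_chart_source _ _
  have hp : p.1 ∈ φ.source := φ.map_target hz
  have hzp : cotChart φ p = z := cotChart_cotChartSymm hφ hz
  have h1 : ContDiffAt ℝ ∞ (cotTransition φ ψ) z := by
    rw [← hzp]
    exact contDiffAt_cotTransition hφ hψ hp hpψ _
  have h2 : cotTransition φ ψ z ∈ (extChartAt (cotangentModel n) p).target := by
    rw [extChartAt_cotangent_target, ← hzp, cotTransition_cotChart hφ hψ hp hpψ]
    exact ⟨ψ.map_source hpψ, Set.mem_univ _⟩
  have h3 : ContMDiffAt 𝓘(ℝ, Rn n × RnDual n) (cotangentModel n) ∞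
      (extChartAt (cotangentModel n) p).symm (cotTransition φ ψ z) :=
    (contMDiffOn_extChartAt_symm p).contMDiffAt
      ((isOpen_extChartAt_target p).mem_nhds h2)
  refine (h3.comp z h1.contMDiffAt).congr_of_eventuallyEq ?_
  have h4 : ∀ᶠ w : Rn n × RnDual n in 𝓝 z, w.1 ∈ φ.target ∧ φ.symm w.1 ∈ ψ.source := by
    have : φ.target ∩ φ.symm ⁻¹' ψ.source ∈ 𝓝 z.1 :=
      inter_mem (φ.open_target.mem_nhds hz) ((φ.continuousAt_symm hz).preimage_mem_nhds
        (ψ.open_source.mem_nhds hpψ))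
    exact continuousAt_fst.preimage_mem_nhds this
  filter_upwards [h4] with w hw
  have hw' : cotTransition φ ψ w = cotChart ψ (cotChartSymm φ w) := by
    rw [← cotTransition_cotChart hφ hψ (φ.map_target hw.1) hw.2, cotChart_cotChartSymm hφ hw.1]
  rw [Function.comp_apply, hw', extChartAt_cotangent_symm_apply p (ψ.map_source hw.2),
    cotChartSymm_cotChart hψ hw.2]

/-- The derivative of a chart of `T*M`, as an endomorphism of the model space. -/
noncomputable def dcotChart (φ : OpenPartialHomeomorph M (Rn n)) (p : CotangentBundle n M) :
    (Rn n × RnDual n) →L[ℝ] (Rn n × RnDual n) :=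
  mfderiv (cotangentModel n) 𝓘(ℝ, Rn n × RnDual n) (cotChart φ) p

/-- The derivative of the inverse of a chart of `T*M`, as an endomorphism of the model space. -/
noncomputable def dcotChartSymm (φ : OpenPartialHomeomorph M (Rn n)) (z : Rn n × RnDual n) :
    (Rn n × RnDual n) →L[ℝ] (Rn n × RnDual n) :=
  mfderiv 𝓘(ℝ, Rn n × RnDual n) (cotangentModel n) (cotChartSymm φ) z

lemma hasMFDerivAt_cotChart (hφ : φ ∈ IsManifold.maximalAtlas (𝓡 n) ∞ M)
    {p : CotangentBundle n M} (hp : p.1 ∈ φ.source) :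
    HasMFDerivAt (cotangentModel n) 𝓘(ℝ, Rn n × RnDual n) (cotChart φ) p (dcotChart φ p) :=
  ((contMDiffAt_cotChart hφ hp).mdifferentiableAt (by simp)).hasMFDerivAt

lemma hasMFDerivAt_cotChartSymm (hφ : φ ∈ IsManifold.maximalAtlas (𝓡 n) ∞ M)
    {z : Rn n × RnDual n} (hz : z.1 ∈ φ.target) :
    HasMFDerivAt 𝓘(ℝ, Rn n × RnDual n) (cotangentModel n) (cotChartSymm φ) z
      (dcotChartSymm φ z) :=
  ((contMDiffAt_cotChartSymm hφ hz).mdifferentiableAt (by simp)).hasMFDerivAt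

lemma dcotChart_comp_dcotChartSymm (hφ : φ ∈ IsManifold.maximalAtlas (𝓡 n) ∞ M)
    {z : Rn n × RnDual n} (hz : z.1 ∈ φ.target) :
    dcotChart φ (cotChartSymm φ z) ∘L dcotChartSymm φ z = ContinuousLinearMap.id ℝ _ := by
  have h1 := HasMFDerivAt.comp z (hasMFDerivAt_cotChart hφ (p := cotChartSymm φ z)
    (φ.map_target hz)) (hasMFDerivAt_cotChartSymm hφ hz)
  have h2 : HasMFDerivAt 𝓘(ℝ, Rn n × RnDual n) 𝓘(ℝ, Rn n × RnDual n)
      (cotChart φ ∘ cotChartSymm φ) z (ContinuousLinearMap.id ℝ _) := by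
    refine (hasMFDerivAt_id z).congr_of_eventuallyEq ?_
    filter_upwards [continuousAt_fst.preimage_mem_nhds (φ.open_target.mem_nhds hz)] with w hw
    exact cotChart_cotChartSymm hφ hw
  exact hasMFDerivAt_unique h1 h2

lemma dcotChartSymm_comp_dcotChart (hφ : φ ∈ IsManifold.maximalAtlas (𝓡 n) ∞ M)
    {p : CotangentBundle n M} (hp : p.1 ∈ φ.source) :
    dcotChartSymm φ (cotChart φ p) ∘L dcotChart φ p = ContinuousLinearMap.id ℝ _ := by
  have h1 := HasMFDerivAt.comp p (hasMFDerivAt_cotChartSymm hφ (z := cotChart φ p)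
    (φ.map_source hp)) (hasMFDerivAt_cotChart hφ hp)
  have h2 : HasMFDerivAt (cotangentModel n) (cotangentModel n)
      (cotChartSymm φ ∘ cotChart φ) p (ContinuousLinearMap.id ℝ _) := by
    refine (hasMFDerivAt_id p).congr_of_eventuallyEq ?_
    filter_upwards [eventually_proj_mem φ.open_source hp] with w hw
    exact cotChartSymm_cotChart hφ hw
  exact hasMFDerivAt_unique h1 h2

lemma dcotChart_transition (hφ : φ ∈ IsManifold.maximalAtlas (𝓡 n) ∞ M)
    (hψ : ψ ∈ IsManifold.maximalAtlas (𝓡 n) ∞ M) {p : CotangentBundle n M}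
    (hp : p.1 ∈ φ.source) (hp' : p.1 ∈ ψ.source) :
    dcotChart ψ p = fderiv ℝ (cotTransition φ ψ) (cotChart φ p) ∘L dcotChart φ p := by
  have h1 : HasMFDerivAt 𝓘(ℝ, Rn n × RnDual n) 𝓘(ℝ, Rn n × RnDual n) (cotTransition φ ψ)
      (cotChart φ p) (fderiv ℝ (cotTransition φ ψ) (cotChart φ p)) :=
    ((contDiffAt_cotTransition hφ hψ hp hp' _).differentiableAt
      (by simp)).hasFDerivAt.hasMFDerivAt
  refine hasMFDerivAt_unique (hasMFDerivAt_cotChart hψ hp')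
    ((HasMFDerivAt.comp p h1 (hasMFDerivAt_cotChart hφ hp)).congr_of_eventuallyEq ?_)
  filter_upwards [eventually_proj_mem φ.open_source hp,
    eventually_proj_mem ψ.open_source hp'] with q hq hq'
  exact (cotTransition_cotChart hφ hψ hq hq').symm

end CotangentCharts

section BilinearSection

set_option maxSynthPendingDepth 3

open ContinuousLinearMap Filter Topology Bundle

variable
  {EB : Type*} [NormedAddCommGroup EB] [NormedSpace ℝ EB]
  {HB : Type*} [TopologicalSpace HB] {IB : ModelWithCorners ℝ EB HB} {k : WithTop ℕ∞}
  {B : Type*} [TopologicalSpace B] [ChartedSpace HB B]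
  {F : Type*} [NormedAddCommGroup F] [NormedSpace ℝ F]
  {E : B → Type*} [TopologicalSpace (TotalSpace F E)]
  [∀ b, TopologicalSpace (E b)] [∀ b, AddCommGroup (E b)] [∀ b, Module ℝ (E b)]
  [FiberBundle F E] [VectorBundle ℝ F E]

/-- A field of bilinear forms is smooth at a point if its coefficients in the trivialization
at that point are. -/
lemma contMDiffAt_bilinear_section {s : ∀ b, E b →L[ℝ] E b →L[ℝ] ℝ} {x₀ : B}
    {f : B → F →L[ℝ] F →L[ℝ] ℝ} (hf : ContMDiffAt IB 𝓘(ℝ, F →L[ℝ] F →L[ℝ] ℝ) k f x₀)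
    (h : ∀ᶠ b in 𝓝 x₀, ∀ v w, s b ((trivializationAt F E x₀).symmL ℝ b v)
      ((trivializationAt F E x₀).symmL ℝ b w) = f b v w) :
    ContMDiffAt IB (IB.prod 𝓘(ℝ, F →L[ℝ] F →L[ℝ] ℝ)) k
      (fun b ↦ TotalSpace.mk' (F →L[ℝ] F →L[ℝ] ℝ) b (s b)) x₀ := by
  rw [contMDiffAt_section]
  refine hf.congr_of_eventuallyEq ?_
  filter_upwards [h, (trivializationAt F E x₀).open_baseSet.mem_nhds
    (FiberBundle.mem_baseSet_trivializationAt' x₀)] with b hb hb'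
  ext v w
  rw [← hb]
  simp [hom_trivializationAt_apply, ContinuousLinearMap.inCoordinates, hb',
    Trivialization.linearMapAt_apply]

end BilinearSection
section SasakianMetric

set_option maxSynthPendingDepth 3

open ContinuousLinearMap Filter Topology Bundle

lemma IsMetricForm.bilinearComp {E F : Type*} [NormedAddCommGroup E] [NormedSpace ℝ E]
    [NormedAddCommGroup F] [NormedSpace ℝ F] {B : E →L[ℝ] E →L[ℝ] ℝ} (h : IsMetricForm B)
    {A : F →L[ℝ] E} (hA : ∀ v, A v = 0 → v = 0) : IsMetricForm (B.bilinearComp A A) where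
  symm _ _ := h.symm _ _
  pos v hv := h.pos _ fun h0 ↦ hv (hA v h0)

lemma IsMetricForm.isVonNBounded {E : Type*} [NormedAddCommGroup E] [NormedSpace ℝ E]
    [FiniteDimensional ℝ E] {B : E →L[ℝ] E →L[ℝ] ℝ} (h : IsMetricForm B) :
    Bornology.IsVonNBounded ℝ {v : E | B v v < 1} := by
  rw [NormedSpace.isVonNBounded_iff' ℝ]
  refine ⟨‖B.inverse‖ * √‖B‖, fun v (hv : B v v < 1) ↦ ?_⟩
  have hBv : B.inverse (B v) = v := h.inverse_eq_iff.2 fun _ ↦ rfl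
  have h1 := h.norm_sq_le (B v)
  rw [hBv] at h1
  have h2 : ‖B v‖ ≤ √‖B‖ := by
    refine Real.le_sqrt_of_sq_le (h1.trans ?_)
    nlinarith [norm_nonneg B]
  calc ‖v‖ = ‖B.inverse (B v)‖ := by rw [hBv]
    _ ≤ ‖B.inverse‖ * ‖B v‖ := le_opNorm _ _
    _ ≤ _ := by gcongr

variable {n : ℕ} {M : Type*} [TopologicalSpace M] [ChartedSpace (Rn n) M]
variable [IsManifold (𝓡 n) ∞ M] {φ ψ : OpenPartialHomeomorph M (Rn n)}

/-- The Sasakian metric at `p`, computed in the chart `φ`. -/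
noncomputable def sasakiAt (g : RiemannianMetricOn n M) (φ : OpenPartialHomeomorph M (Rn n))
    (p : CotangentBundle n M) : (Rn n × RnDual n) →L[ℝ] (Rn n × RnDual n) →L[ℝ] ℝ :=
  (sasakiForm (metricCoord g φ) (cotChart φ p)).bilinearComp (dcotChart φ p) (dcotChart φ p)

lemma isMetricForm_sasakiAt (g : RiemannianMetricOn n M)
    (hφ : φ ∈ IsManifold.maximalAtlas (𝓡 n) ∞ M) {p : CotangentBundle n M}
    (hp : p.1 ∈ φ.source) : IsMetricForm (sasakiAt g φ p) := by
  refine (isMetricForm_sasakiForm (isMetricForm_metricCoord g hφ (φ.map_source hp))).bilinearComp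
    fun v hv ↦ ?_
  have := congr($(dcotChartSymm_comp_dcotChart hφ hp) v)
  simpa [hv] using this.symm

/-- The Sasakian metric does not depend on the chart. -/
lemma sasakiAt_eq (g : RiemannianMetricOn n M) (hφ : φ ∈ IsManifold.maximalAtlas (𝓡 n) ∞ M)
    (hψ : ψ ∈ IsManifold.maximalAtlas (𝓡 n) ∞ M) {p : CotangentBundle n M}
    (hp : p.1 ∈ φ.source) (hp' : p.1 ∈ ψ.source) : sasakiAt g φ p = sasakiAt g ψ p := by
  set x := p.1 with hx
  have hinv : ∀ a, fderiv ℝ (φ ∘ ψ.symm) (ψ x) (fderiv ℝ (ψ ∘ φ.symm) (φ x) a) = a := by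
    intro a
    rw [fderiv_transition hφ hψ hp hp', fderiv_transition hψ hφ hp' hp]
    have h1 := congr($(dsymm_comp_dchart hψ hp') (dsymm φ (φ x) a))
    have h2 := congr($(dchart_comp_dsymm' hφ hp) a)
    simp only [comp_apply, id_apply] at h1 h2 ⊢
    rw [h1, h2]
  have hσx : (φ ∘ ψ.symm) (ψ x) = φ x := by simp [ψ.left_inv hp']
  have hmem : φ x ∈ φ.target := φ.map_source hp
  have hmem' : ψ x ∈ ψ.target := ψ.map_source hp'
  have hB := ((contDiffOn_metricCoord g hφ).contDiffAt
    (φ.open_target.mem_nhds hmem)).differentiableAt (by simp)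
  have hB' := ((contDiffOn_metricCoord g hψ).contDiffAt
    (ψ.open_target.mem_nhds hmem')).differentiableAt (by simp)
  have hev : metricCoord g ψ =ᶠ[𝓝 (ψ x)] fun w ↦ (metricCoord g φ ((φ ∘ ψ.symm) w)).bilinearComp
      (fderiv ℝ (φ ∘ ψ.symm) w) (fderiv ℝ (φ ∘ ψ.symm) w) := by
    have : ψ.target ∩ ψ.symm ⁻¹' φ.source ∈ 𝓝 (ψ x) := by
      refine inter_mem (ψ.open_target.mem_nhds hmem') ((ψ.continuousAt_symm hmem').preimage_mem_nhds
        (φ.open_source.mem_nhds ?_))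
      rwa [ψ.left_inv hp']
    filter_upwards [this] with w hw
    have := metricCoord_transition g hψ hφ (ψ.map_target hw.1) hw.2
    rwa [ψ.right_inv hw.1] at this
  have hm := isMetricForm_metricCoord g hφ hmem
  have hm' := isMetricForm_metricCoord g hψ hmem'
  rw [← hσx] at hB hm
  obtain ⟨η, hη⟩ : ∃ η, cotChart φ p = (φ x, η) := ⟨_, rfl⟩
  have hη' : cotChart ψ p = (ψ x, η ∘L fderiv ℝ (φ ∘ ψ.symm) (ψ x)) := by
    rw [← cotTransition_cotChart hφ hψ hp hp', hη]
    simp [cotTransition, φ.left_inv hp]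
  refine ContinuousLinearMap.ext fun v ↦ ContinuousLinearMap.ext fun w ↦ ?_
  simp only [sasakiAt, bilinearComp_apply]
  rw [dcotChart_transition hφ hψ hp hp', comp_apply, comp_apply, hη, hη',
    fderiv_cotTransition hφ hψ hp hp', fderiv_cotTransition hφ hψ hp hp']
  have key := sasakiForm_bilinearComp_fderiv
    ((contDiffAt_transition hψ hφ hp' hp).of_le (WithTop.coe_le_coe.2 le_top)) hB hev hB' hm hm'
    (fun a ↦ ⟨_, hinv a⟩) η (fderiv ℝ (ψ ∘ φ.symm) (φ x) (dcotChart φ p v).1)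
    (fderiv ℝ (ψ ∘ φ.symm) (φ x) (dcotChart φ p w).1) (dcotChart φ p v).2 (dcotChart φ p w).2
  rw [hinv, hinv, hσx] at key
  exact key.symm

lemma symmL_trivializationAt_cotangent (p₀ : CotangentBundle n M) {p : CotangentBundle n M}
    (hp : p.1 ∈ (chartAt (Rn n) p₀.1).source) :
    (trivializationAt (Rn n × RnDual n) (TangentSpace (cotangentModel n)) p₀).symmL ℝ p =
      dcotChartSymm (chartAt (Rn n) p₀.1) (cotChart (chartAt (Rn n) p₀.1) p) := by
  have hs : p ∈ (extChartAt (cotangentModel n) p₀).source := by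
    rw [extChartAt_cotangent_source]; exact hp
  rw [TangentBundle.symmL_trivializationAt (by rwa [extChartAt_source] at hs)]
  have : Set.range (cotangentModel n) = Set.univ := by
    rw [modelWithCorners_prod_coe]; simp
  rw [this, mfderivWithin_univ]
  have h1 : (extChartAt (cotangentModel n) p₀).symm =ᶠ[𝓝 (extChartAt (cotangentModel n) p₀ p)]
      cotChartSymm (chartAt (Rn n) p₀.1) := by
    have := (extChartAt (cotangentModel n) p₀).map_source hs
    filter_upwards [(isOpen_extChartAt_target p₀).mem_nhds this] with z hz
    rw [extChartAt_cotangent_target] at hz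
    exact extChartAt_cotangent_symm_apply p₀ hz.1
  rw [h1.mfderiv_eq, extChartAt_cotangent_apply p₀ hp]
  rfl

/-- The Sasakian inner product on the tangent space of `T*M` at `p`. -/
noncomputable def sasakiInner (g : RiemannianMetricOn n M) (p : CotangentBundle n M) :
    TangentSpace (cotangentModel n) p →L[ℝ] TangentSpace (cotangentModel n) p →L[ℝ] ℝ :=
  sasakiAt g (chartAt (Rn n) p.1) p

/-- The Sasakian metric of `g` on the cotangent bundle. -/
noncomputable def sasakiMetric (g : RiemannianMetricOn n M) : CotangentRiemannianMetric n M where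
  inner p := sasakiInner g p
  symm p v w := (isMetricForm_sasakiAt g (IsManifold.chart_mem_maximalAtlas p.1)
    (mem_chart_source _ p.1)).symm v w
  pos p v hv := (isMetricForm_sasakiAt g (IsManifold.chart_mem_maximalAtlas p.1)
    (mem_chart_source _ p.1)).pos v hv
  isVonNBounded p := (isMetricForm_sasakiAt g (IsManifold.chart_mem_maximalAtlas p.1)
    (mem_chart_source _ p.1)).isVonNBounded
  contMDiff := by
    intro p₀
    set ψ := chartAt (Rn n) p₀.1 with hψ'
    have hψ : ψ ∈ IsManifold.maximalAtlas (𝓡 n) ∞ M := IsManifold.chart_mem_maximalAtlas _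
    have hp : p₀.1 ∈ ψ.source := mem_chart_source _ _
    have h1 : ContDiffAt ℝ ∞ (sasakiForm (metricCoord g ψ)) (cotChart ψ p₀) :=
      (contDiffOn_sasakiForm ψ.open_target (contDiffOn_metricCoord g hψ)
        (fun u hu ↦ isMetricForm_metricCoord g hψ hu)).contDiffAt
        ((ψ.open_target.prod isOpen_univ).mem_nhds ⟨ψ.map_source hp, Set.mem_univ _⟩)
    refine contMDiffAt_bilinear_section (h1.contMDiffAt.comp p₀ (contMDiffAt_cotChart hψ hp)) ?_
    filter_upwards [eventually_proj_mem ψ.open_source hp] with p hpψ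
    intro v w
    have h2 : (dcotChart ψ p ∘L dcotChartSymm ψ (cotChart ψ p)) = ContinuousLinearMap.id ℝ _ := by
      have := dcotChart_comp_dcotChartSymm hψ (z := cotChart ψ p) (ψ.map_source hpψ)
      rwa [cotChartSymm_cotChart hψ hpψ] at this
    have h3 : sasakiAt g (chartAt (Rn n) p.1) p (dcotChartSymm ψ (cotChart ψ p) v)
        (dcotChartSymm ψ (cotChart ψ p) w) = sasakiForm (metricCoord g ψ) (cotChart ψ p) v w := by
      rw [sasakiAt_eq g (IsManifold.chart_mem_maximalAtlas p.1) hψ (mem_chart_source _ p.1) hpψ]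
      simp only [sasakiAt, bilinearComp_apply]
      have := fun v ↦ congr($h2 v)
      simp only [comp_apply, id_apply] at this
      rw [this, this]
    rw [symmL_trivializationAt_cotangent p₀ hpψ]
    exact h3

end SasakianMetric

section Frame

set_option maxSynthPendingDepth 3

open ContinuousLinearMap Filter Topology Bundle

variable {n : ℕ}

/-- The `i`-th coordinate form on the model space. -/
noncomputable def coordForm (i : Fin n) : RnDual n := EuclideanSpace.proj i

lemma coordForm_apply (i : Fin n) (v : Rn n) : coordForm i v = v i := rfl

lemma coordForm_stdVec (i j : Fin n) : coordForm i (stdVec j) = if i = j then 1 else 0 := by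
  simp [coordForm_apply, stdVec]

lemma sum_smul_stdVec (v : Rn n) : ∑ i, v i • stdVec i = v := by
  ext j
  simp [stdVec, Pi.single_apply]

lemma sum_smul_coordForm (κ : RnDual n) : ∑ i, κ (stdVec i) • coordForm i = κ := by
  ext v
  conv_rhs => rw [← sum_smul_stdVec v]
  simp [coordForm_apply, mul_comm]

/-- The covector with coordinates `y`. -/
noncomputable def covecOfCoords : Rn n →L[ℝ] RnDual n :=
  ∑ i, (coordForm i).smulRight (coordForm i)

lemma covecOfCoords_apply (y : Rn n) : covecOfCoords y = ∑ i, y i • coordForm i := by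
  simp [covecOfCoords, sum_apply, coordForm_apply]

lemma covecOfCoords_stdVec (i : Fin n) : covecOfCoords (stdVec i) = coordForm i := by
  rw [covecOfCoords_apply, Finset.sum_eq_single i] <;> simp +contextual [stdVec]

lemma covecOfCoords_apply_apply (y v : Rn n) : covecOfCoords y v = ∑ i, y i * v i := by
  simp [covecOfCoords_apply, sum_apply, coordForm_apply]

lemma exists_covecOfCoords (η : RnDual n) : ∃ y, covecOfCoords y = η :=
  ⟨∑ i, η (stdVec i) • stdVec i, by simp [covecOfCoords_stdVec, sum_smul_coordForm]⟩

variable {B : Rn n → Rn n →L[ℝ] Rn n →L[ℝ] ℝ}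

/-- The horizontal lift of the `i`-th standard vector, in coordinates. -/
noncomputable def horizontalVec (B : Rn n → Rn n →L[ℝ] Rn n →L[ℝ] ℝ) (z : Rn n × RnDual n)
    (i : Fin n) : Rn n × RnDual n :=
  (stdVec i, z.2 ∘L christoffelMap B z.1 (stdVec i))

lemma connector_horizontalVec (z : Rn n × RnDual n) (i : Fin n) :
    connector B z (horizontalVec B z i) = 0 := by
  simp [connector_apply, horizontalVec]

lemma connector_vertical (z : Rn n × RnDual n) (κ : RnDual n) :
    connector B z (0, κ) = κ := by
  ext; simp [connector_apply]

lemma eq_sum_frame (B : Rn n → Rn n →L[ℝ] Rn n →L[ℝ] ℝ) (z v : Rn n × RnDual n) :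
    v = ∑ i, v.1 i • horizontalVec B z i +
      ∑ i, connector B z v (stdVec i) • ((0, coordForm i) : Rn n × RnDual n) := by
  refine Prod.ext ?_ ?_
  · simp [Prod.fst_sum, horizontalVec, sum_smul_stdVec]
  · have h : ∑ i, v.1 i • z.2 ∘L christoffelMap B z.1 (stdVec i) =
        z.2 ∘L christoffelMap B z.1 v.1 := by
      conv_rhs => rw [← sum_smul_stdVec v.1]
      ext w
      simp [sum_apply]
    simp only [Prod.snd_add, Prod.snd_sum, Prod.smul_snd, horizontalVec, sum_smul_coordForm]
    rw [h, connector_apply]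
    simp

lemma ext_frame {X : Type*} [NormedAddCommGroup X] [NormedSpace ℝ X] (z : Rn n × RnDual n)
    {L₁ L₂ : (Rn n × RnDual n) →L[ℝ] X}
    (hh : ∀ i, L₁ (horizontalVec B z i) = L₂ (horizontalVec B z i))
    (hv : ∀ i, L₁ (0, coordForm i) = L₂ (0, coordForm i)) : L₁ = L₂ := by
  refine ContinuousLinearMap.ext fun v ↦ ?_
  rw [eq_sum_frame B z v]
  simp only [map_add, map_sum, map_smul, hh, hv]

lemma sasakiForm_horizontal_horizontal (z : Rn n × RnDual n) (i j : Fin n) :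
    sasakiForm B z (horizontalVec B z i) (horizontalVec B z j) =
      B z.1 (stdVec i) (stdVec j) := by
  rw [sasakiForm_apply, connector_horizontalVec]
  simp [horizontalVec]

lemma sasakiForm_horizontal_vertical (z : Rn n × RnDual n) (i : Fin n) (κ : RnDual n) :
    sasakiForm B z (horizontalVec B z i) (0, κ) = 0 := by
  simp [sasakiForm_apply, connector_horizontalVec]

lemma sasakiForm_vertical_vertical (z : Rn n × RnDual n) (κ μ : RnDual n) :
    sasakiForm B z (0, κ) (0, μ) = μ ((B z.1).inverse κ) := by
  simp [sasakiForm_apply, connector_vertical]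

variable {M : Type*} [TopologicalSpace M] [ChartedSpace (Rn n) M]
variable [IsManifold (𝓡 n) ∞ M] {φ : OpenPartialHomeomorph M (Rn n)}

lemma gCoeff_apply (g : RiemannianMetricOn n M) (u : Rn n) (i j : Fin n) :
    gCoeff g φ u i j = metricCoord g φ u (stdVec i) (stdVec j) := rfl

lemma gInvCoeff_apply (g : RiemannianMetricOn n M) (hφ : φ ∈ IsManifold.maximalAtlas (𝓡 n) ∞ M)
    {u : Rn n} (hu : u ∈ φ.target) (i j : Fin n) :
    gInvCoeff g φ u i j = (metricCoord g φ u).inverse (coordForm j) i := by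
  have hm := isMetricForm_metricCoord g hφ hu
  have : gInvCoeff g φ u =
      Matrix.of fun i j ↦ (metricCoord g φ u).inverse (coordForm j) i := by
    refine Matrix.inv_eq_right_inv ?_
    ext i j
    have h1 := congr($(hm.apply_inverse (coordForm j)) (stdVec i))
    rw [hm.symm, coordForm_stdVec] at h1
    rw [Matrix.mul_apply, Matrix.one_apply]
    simp only [gCoeff_apply, Matrix.of_apply, @eq_comm _ i j]
    rw [← h1]
    conv_rhs => rw [← sum_smul_stdVec ((metricCoord g φ u).inverse (coordForm j))]
    simp [mul_comm]
  rw [this]; rfl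

lemma christoffel_eq (g : RiemannianMetricOn n M) (hφ : φ ∈ IsManifold.maximalAtlas (𝓡 n) ∞ M)
    {u : Rn n} (hu : u ∈ φ.target) (k i j : Fin n) :
    christoffel g φ u k i j =
      christoffelMap (metricCoord g φ) u (stdVec i) (stdVec j) k := by
  have hd : DifferentiableAt ℝ (metricCoord g φ) u :=
    ((contDiffOn_metricCoord g hφ).contDiffAt (φ.open_target.mem_nhds hu)).differentiableAt
      (by simp)
  have hdg : ∀ k i j, dgCoeff g φ u k i j =
      fderiv ℝ (metricCoord g φ) u (stdVec k) (stdVec i) (stdVec j) := fun k i j ↦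
    fderiv_apply_apply hd _ _ _
  rw [christoffelMap_apply, ← sum_smul_coordForm (koszulForm _ _ _), christoffel, Finset.mul_sum,
    map_sum, WithLp.ofLp_sum, Finset.sum_apply]
  refine Finset.sum_congr rfl fun l _ ↦ ?_
  rw [gInvCoeff_apply g hφ hu, hdg, hdg, hdg, koszulForm_apply]
  simp
  ring

lemma cotParam_eq (z : Rn n × Rn n) :
    cotParam (M := M) φ z = cotChartSymm φ (z.1, covecOfCoords z.2) := by
  have : ∀ y : Rn n, ∑ i, y i • coordCovec φ z.1 i =
      (covecOfCoords y ∘L dchart φ (φ.symm z.1) : RnDual n) := by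
    intro y
    change (∑ i, y i • (coordForm i ∘L dchart φ (φ.symm z.1)) : RnDual n) = _
    rw [covecOfCoords_apply]
    ext v
    simp [sum_apply]
  simp only [cotParam, cotChartSymm, this]

lemma mfderiv_cotParam (hφ : φ ∈ IsManifold.maximalAtlas (𝓡 n) ∞ M) {z : Rn n × Rn n}
    (hz : z.1 ∈ φ.target) (v : Rn n × Rn n) :
    (mfderiv 𝓘(ℝ, Rn n × Rn n) (cotangentModel n) (cotParam (M := M) φ) z v : Rn n × RnDual n) =
      dcotChartSymm (M := M) φ (z.1, covecOfCoords z.2) (v.1, covecOfCoords v.2) := by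
  have h0 : cotParam (M := M) φ =
      cotChartSymm φ ∘ ((ContinuousLinearMap.id ℝ (Rn n)).prodMap covecOfCoords) :=
    funext fun z ↦ cotParam_eq z
  have h1 := HasMFDerivAt.comp z (hasMFDerivAt_cotChartSymm hφ
    (z := ((ContinuousLinearMap.id ℝ (Rn n)).prodMap covecOfCoords) z) hz)
    ((ContinuousLinearMap.id ℝ (Rn n)).prodMap
      (covecOfCoords (n := n))).hasFDerivAt.hasMFDerivAt
  rw [← h0] at h1
  rw [h1.mfderiv]
  rfl

lemma cotBaseVec_eq (hφ : φ ∈ IsManifold.maximalAtlas (𝓡 n) ∞ M) {z : Rn n × Rn n}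
    (hz : z.1 ∈ φ.target) (i : Fin n) :
    (cotBaseVec (M := M) φ z i : Rn n × RnDual n) =
      dcotChartSymm (M := M) φ (z.1, covecOfCoords z.2) (stdVec i, 0) := by
  have := mfderiv_cotParam hφ hz (stdVec i, 0)
  rw [map_zero] at this
  exact this

lemma cotFibreVec_eq (hφ : φ ∈ IsManifold.maximalAtlas (𝓡 n) ∞ M) {z : Rn n × Rn n}
    (hz : z.1 ∈ φ.target) (i : Fin n) :
    (cotFibreVec (M := M) φ z i : Rn n × RnDual n) =
      dcotChartSymm (M := M) φ (z.1, covecOfCoords z.2) (0, coordForm i) := by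
  have := mfderiv_cotParam hφ hz (0, stdVec i)
  rw [covecOfCoords_stdVec] at this
  exact this

lemma horVec_eq (g : RiemannianMetricOn n M) (hφ : φ ∈ IsManifold.maximalAtlas (𝓡 n) ∞ M)
    {z : Rn n × Rn n} (hz : z.1 ∈ φ.target) (i : Fin n) :
    (horVec g φ z i : Rn n × RnDual n) =
      dcotChartSymm (M := M) φ (z.1, covecOfCoords z.2)
        (horizontalVec (metricCoord g φ) (z.1, covecOfCoords z.2) i) := by
  have h1 : horizontalVec (metricCoord g φ) (z.1, covecOfCoords z.2) i =
      (stdVec i, 0) + ∑ s, ∑ k, (christoffel g φ z.1 k i s * z.2 k) •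
        ((0, coordForm s) : Rn n × RnDual n) := by
    refine Prod.ext (by simp [horizontalVec, Prod.fst_sum]) ?_
    simp only [horizontalVec, Prod.snd_add, Prod.snd_sum, Prod.smul_snd, zero_add,
      ← Finset.sum_smul]
    rw [← sum_smul_coordForm (covecOfCoords z.2 ∘L _)]
    refine Finset.sum_congr rfl fun s _ ↦ ?_
    rw [comp_apply, covecOfCoords_apply_apply]
    congr 1
    exact Finset.sum_congr rfl fun k _ ↦ by rw [christoffel_eq g hφ hz, mul_comm]
  rw [h1]
  simp only [map_add, map_sum, map_smul]
  rw [← cotBaseVec_eq hφ hz]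
  simp only [← cotFibreVec_eq hφ hz]
  rfl

/-- A metric on `T*M` at a point, as a bilinear form on the model space. -/
noncomputable def cotMetricAt (G : CotangentRiemannianMetric n M) (p : CotangentBundle n M) :
    (Rn n × RnDual n) →L[ℝ] (Rn n × RnDual n) →L[ℝ] ℝ :=
  G.inner p

lemma cotMetricAt_comm (G : CotangentRiemannianMetric n M) (p : CotangentBundle n M)
    (v w : Rn n × RnDual n) : cotMetricAt G p v w = cotMetricAt G p w v :=
  G.symm p v w

/-- The defining equations of the Sasakian metric determine it in each chart. -/
lemma isSasakianMetric_iff (g : RiemannianMetricOn n M) (G : CotangentRiemannianMetric n M) :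
    IsSasakianMetric g G ↔ ∀ φ ∈ IsManifold.maximalAtlas (𝓡 n) ∞ M,
      ∀ p : CotangentBundle n M, p.1 ∈ φ.source → cotMetricAt G p = sasakiAt g φ p := by
  have hframe : IsSasakianMetric g G ↔ ∀ φ ∈ IsManifold.maximalAtlas (𝓡 n) ∞ M, ∀ u ∈ φ.target,
      ∀ (y : Rn n) (i j : Fin n),
      cotMetricAt G (cotChartSymm φ (u, covecOfCoords y))
          (dcotChartSymm (M := M) φ (u, covecOfCoords y)
            (horizontalVec (metricCoord g φ) (u, covecOfCoords y) i))
          (dcotChartSymm (M := M) φ (u, covecOfCoords y)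
            (horizontalVec (metricCoord g φ) (u, covecOfCoords y) j)) = gCoeff g φ u i j ∧
      cotMetricAt G (cotChartSymm φ (u, covecOfCoords y))
          (dcotChartSymm (M := M) φ (u, covecOfCoords y)
            (horizontalVec (metricCoord g φ) (u, covecOfCoords y) i))
          (dcotChartSymm (M := M) φ (u, covecOfCoords y) (0, coordForm j)) = 0 ∧
      cotMetricAt G (cotChartSymm φ (u, covecOfCoords y))
          (dcotChartSymm (M := M) φ (u, covecOfCoords y) (0, coordForm i))
          (dcotChartSymm (M := M) φ (u, covecOfCoords y) (0, coordForm j)) =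
        gInvCoeff g φ u i j := by
    refine forall₂_congr fun φ hφ ↦ forall₂_congr fun u hu ↦ forall_congr' fun y ↦
      forall₂_congr fun i j ↦ ?_
    have e1 := fun i ↦ horVec_eq g hφ (z := (u, y)) hu i
    have e2 := fun i ↦ cotFibreVec_eq hφ (M := M) (z := (u, y)) hu i
    have e3 := cotParam_eq (M := M) (φ := φ) (u, y)
    simp only at e1 e2 e3
    rw [← e1, ← e1, ← e2, ← e2, ← e3]
    rfl
  rw [hframe]
  refine forall₂_congr fun φ hφ ↦ ⟨fun h p hp ↦ ?_, fun h u hu y i j ↦ ?_⟩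
  · obtain ⟨y, hy⟩ := exists_covecOfCoords (cotChart φ p).2
    have hz : ((φ p.1, covecOfCoords y) : Rn n × RnDual n) = cotChart φ p := Prod.ext rfl hy
    have hu := φ.map_source hp
    have hk := h (φ p.1) hu y
    rw [hz, cotChartSymm_cotChart hφ hp] at hk
    set z := cotChart φ p with hzdef
    set D := dcotChartSymm (M := M) φ z
    set B := metricCoord g φ
    have hm : IsMetricForm (B z.1) := isMetricForm_metricCoord g hφ hu
    have h1 : (cotMetricAt G p).bilinearComp D D = sasakiForm B z := by
      refine ext_frame (B := B) z (fun i ↦ ext_frame (B := B) z (fun j ↦ ?_) fun j ↦ ?_)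
        fun i ↦ ext_frame (B := B) z (fun j ↦ ?_) fun j ↦ ?_
      · rw [bilinearComp_apply, (hk i j).1, sasakiForm_horizontal_horizontal]
        rfl
      · rw [bilinearComp_apply, (hk i j).2.1, sasakiForm_horizontal_vertical]
      · rw [bilinearComp_apply, cotMetricAt_comm, (hk j i).2.1,
          (isMetricForm_sasakiForm hm).symm, sasakiForm_horizontal_vertical]
      · rw [bilinearComp_apply, (hk i j).2.2, sasakiForm_vertical_vertical,
          gInvCoeff_apply g hφ hu, hm.dual_symm]
        rfl
    refine ContinuousLinearMap.ext fun v ↦ ContinuousLinearMap.ext fun w ↦ ?_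
    have h2 := fun v ↦ congr($(dcotChartSymm_comp_dcotChart hφ hp) v)
    simp only [comp_apply, id_apply] at h2
    rw [sasakiAt, ← hzdef, ← h1]
    simp only [bilinearComp_apply]
    rw [h2, h2]
  · have hk := h (cotChartSymm φ (u, covecOfCoords y)) (φ.map_target hu)
    have h2 := fun v ↦ congr($(dcotChart_comp_dcotChartSymm (M := M) hφ
      (z := (u, covecOfCoords y)) hu) v)
    simp only [comp_apply, id_apply] at h2
    rw [hk]
    simp only [sasakiAt, bilinearComp_apply, h2]
    rw [cotChart_cotChartSymm hφ hu, sasakiForm_horizontal_horizontal,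
      sasakiForm_horizontal_vertical, sasakiForm_vertical_vertical, gInvCoeff_apply g hφ hu,
      (isMetricForm_metricCoord g hφ hu).dual_symm]
    exact ⟨rfl, rfl, rfl⟩

lemma isSasakianMetric_sasakiMetric (g : RiemannianMetricOn n M) :
    IsSasakianMetric g (sasakiMetric g) :=
  (isSasakianMetric_iff g _).2 fun _ hφ _ hp ↦
    sasakiAt_eq g (IsManifold.chart_mem_maximalAtlas _) hφ (mem_chart_source _ _) hp

lemma IsSasakianMetric.eq {g : RiemannianMetricOn n M} {G₁ G₂ : CotangentRiemannianMetric n M}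
    (h₁ : IsSasakianMetric g G₁) (h₂ : IsSasakianMetric g G₂) : G₁ = G₂ := by
  have h : G₁.inner = G₂.inner := funext fun p ↦
    ((isSasakianMetric_iff g G₁).1 h₁ _ (IsManifold.chart_mem_maximalAtlas p.1) p
      (mem_chart_source _ _)).trans
    ((isSasakianMetric_iff g G₂).1 h₂ _ (IsManifold.chart_mem_maximalAtlas p.1) p
      (mem_chart_source _ _)).symm
  cases G₁
  cases G₂
  congr

end Frame

section RiemannianLipschitz

set_option maxSynthPendingDepth 3

open Set MeasureTheory Manifold

variable {E : Type*} [NormedAddCommGroup E] [NormedSpace ℝ E]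
  {H : Type*} [TopologicalSpace H] {I : ModelWithCorners ℝ E H}
  {N : Type*} [TopologicalSpace N] [ChartedSpace H N]

/-- The differential of a real function, as a linear form. -/
noncomputable def realDiff (I : ModelWithCorners ℝ E H) (f : N → ℝ) (x : N) :
    TangentSpace I x →L[ℝ] ℝ :=
  mfderiv I 𝓘(ℝ, ℝ) f x

/-- A `C¹` function whose differential has norm at most `1` is `1`-Lipschitz for the Riemannian
distance. -/
lemma edist_le_riemannianEDist [∀ x : N, ENorm (TangentSpace I x)] {f : N → ℝ}
    (hf : ContMDiff I 𝓘(ℝ, ℝ) 1 f)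
    (hf' : ∀ (x : N) (v : TangentSpace I x), ‖realDiff I f x v‖ₑ ≤ ‖v‖ₑ) (x y : N) :
    edist (f x) (f y) ≤ riemannianEDist I x y := by
  refine le_of_forall_gt fun r hr ↦ ?_
  obtain ⟨γ, rfl, rfl, hγ, hlen⟩ := exists_lt_of_riemannianEDist_lt hr
  refine lt_of_le_of_lt ?_ hlen
  have hfγ : ContDiffOn ℝ 1 (f ∘ γ) (Icc 0 1) :=
    contMDiffOn_iff_contDiffOn.1 (hf.comp_contMDiffOn hγ)
  rw [edist_comm, edist_eq_enorm_sub, pathELength_eq_lintegral_mfderivWithin_Icc]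
  refine (enorm_sub_le_lintegral_derivWithin_Icc_of_contDiffOn_Icc hfγ zero_le_one).trans ?_
  refine setLIntegral_mono' measurableSet_Icc fun t ht ↦ ?_
  have hc : mfderivWithin 𝓘(ℝ, ℝ) 𝓘(ℝ, ℝ) (f ∘ γ) (Icc 0 1) t =
      (mfderiv I 𝓘(ℝ, ℝ) f (γ t)) ∘L (mfderivWithin 𝓘(ℝ, ℝ) I γ (Icc 0 1) t) := by
    apply mfderiv_comp_mfderivWithin
    · exact (hf.mdifferentiable one_ne_zero) _
    · exact (hγ.mdifferentiableOn one_ne_zero) t ht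
    · rw [uniqueMDiffWithinAt_iff_uniqueDiffWithinAt]
      exact uniqueDiffOn_Icc zero_lt_one t ht
  have hd : derivWithin (f ∘ γ) (Icc 0 1) t =
      realDiff I f (γ t) (mfderivWithin 𝓘(ℝ, ℝ) I γ (Icc 0 1) t 1) := by
    rw [← fderivWithin_derivWithin, ← mfderivWithin_eq_fderivWithin]
    exact congr($hc 1)
  rw [hd]
  exact hf' _ _

variable [IsManifold I 1 N]
  (G : Bundle.ContMDiffRiemannianMetric I ∞ E (fun x : N ↦ TangentSpace I x))

lemma edist_le_riemannianEDist_of_sq_le {f : N → ℝ} (hf : ContMDiff I 𝓘(ℝ, ℝ) 1 f)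
    (hf' : ∀ (x : N) (v : TangentSpace I x), realDiff I f x v ^ 2 ≤ G.inner x v v) (x y : N) :
    letI : Bundle.RiemannianBundle (fun x : N ↦ TangentSpace I x) := ⟨G.toRiemannianMetric⟩
    edist (f x) (f y) ≤ riemannianEDist I x y := by
  let : Bundle.RiemannianBundle (fun x : N ↦ TangentSpace I x) := ⟨G.toRiemannianMetric⟩
  refine edist_le_riemannianEDist hf (fun x v ↦ ?_) x y
  rw [enorm_le_iff_norm_le, norm_eq_sqrt_real_inner v, Real.norm_eq_abs]
  exact Real.abs_le_sqrt (hf' x v)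

lemma riemannianEDist_comm_of_metric (x y : N) :
    letI : Bundle.RiemannianBundle (fun x : N ↦ TangentSpace I x) := ⟨G.toRiemannianMetric⟩
    riemannianEDist I x y = riemannianEDist I y x := by
  let : Bundle.RiemannianBundle (fun x : N ↦ TangentSpace I x) := ⟨G.toRiemannianMetric⟩
  exact riemannianEDist_comm

lemma riemannianEDist_triangle_of_metric (x y z : N) :
    letI : Bundle.RiemannianBundle (fun x : N ↦ TangentSpace I x) := ⟨G.toRiemannianMetric⟩
    riemannianEDist I x z ≤ riemannianEDist I x y + riemannianEDist I y z := by
  let : Bundle.RiemannianBundle (fun x : N ↦ TangentSpace I x) := ⟨G.toRiemannianMetric⟩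
  exact riemannianEDist_triangle

lemma eventually_riemannianEDist_lt_of_metric (x : N) {ε : ℝ≥0∞} (hε : 0 < ε) :
    letI : Bundle.RiemannianBundle (fun x : N ↦ TangentSpace I x) := ⟨G.toRiemannianMetric⟩
    ∀ᶠ y in nhds x, riemannianEDist I x y < ε := by
  let : Bundle.RiemannianBundle (fun x : N ↦ TangentSpace I x) := ⟨G.toRiemannianMetric⟩
  have : IsContinuousRiemannianBundle E (fun x : N ↦ TangentSpace I x) :=
    ⟨G.inner, G.contMDiff.continuous, fun _ _ _ ↦ rfl⟩
  exact eventually_riemannianEDist_lt I x hε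

end RiemannianLipschitz

section Distance

open Filter Topology

variable {n : ℕ} {M : Type*} [TopologicalSpace M] [ChartedSpace (Rn n) M]
variable [IsManifold (𝓡 n) ∞ M]

lemma cotDist_comm (G : CotangentRiemannianMetric n M) (p q : CotangentBundle n M) :
    cotDist G p q = cotDist G q p :=
  riemannianEDist_comm_of_metric G p q

lemma cotDist_triangle (G : CotangentRiemannianMetric n M) (p q r : CotangentBundle n M) :
    cotDist G p r ≤ cotDist G p q + cotDist G q r :=
  riemannianEDist_triangle_of_metric G p q r

lemma eventually_cotDist_lt (G : CotangentRiemannianMetric n M) (p : CotangentBundle n M)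
    {ε : ℝ≥0∞} (hε : 0 < ε) : ∀ᶠ q in 𝓝 p, cotDist G p q < ε :=
  eventually_riemannianEDist_lt_of_metric G p hε

lemma edist_le_cotDist (G : CotangentRiemannianMetric n M) {f : CotangentBundle n M → ℝ}
    (hf : ContMDiff (cotangentModel n) 𝓘(ℝ, ℝ) 1 f)
    (hf' : ∀ p v, realDiff (cotangentModel n) f p v ^ 2 ≤ G.inner p v v)
    (p q : CotangentBundle n M) : edist (f p) (f q) ≤ cotDist G p q :=
  edist_le_riemannianEDist_of_sq_le G hf hf' p q

end Distance

section Completeness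

set_option maxSynthPendingDepth 3

open ContinuousLinearMap Filter Topology Bundle

variable {n : ℕ} {M : Type*} [TopologicalSpace M] [ChartedSpace (Rn n) M]
variable [IsManifold (𝓡 n) ∞ M] {φ : OpenPartialHomeomorph M (Rn n)}

/-- The function `√(1 + |η|²)` on the cotangent bundle. -/
noncomputable def covecSize (g : RiemannianMetricOn n M) (p : CotangentBundle n M) : ℝ :=
  √(1 + covecOf p ((metricAt g p.1).inverse (covecOf p)))

lemma covecSize_eq (g : RiemannianMetricOn n M) (hφ : φ ∈ IsManifold.maximalAtlas (𝓡 n) ∞ M)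
    {p : CotangentBundle n M} (hp : p.1 ∈ φ.source) :
    covecSize g p = √(1 + (cotChart φ p).2
      ((metricCoord g φ (cotChart φ p).1).inverse (cotChart φ p).2)) := by
  have hB : metricCoord g φ (φ p.1) =
      (metricAt g p.1).bilinearComp (dsymm φ (φ p.1)) (dsymm φ (φ p.1)) := by
    rw [metricCoord, φ.left_inv hp]
  have hm' := isMetricForm_metricCoord g hφ (φ.map_source hp)
  rw [hB] at hm'
  have hm : IsMetricForm (metricAt g p.1) := ⟨g.symm p.1, g.pos p.1⟩
  have hs : Function.Surjective (dsymm φ (φ p.1)) := fun v ↦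
    ⟨dchart φ p.1 v, congr($(dsymm_comp_dchart hφ hp) v)⟩
  have key : ∀ η : RnDual n, (η ∘L dsymm φ (φ p.1))
      ((metricCoord g φ (φ p.1)).inverse (η ∘L dsymm φ (φ p.1))) =
      η ((metricAt g p.1).inverse η) := fun η ↦ by
    rw [hB, comp_apply, hm.apply_inverse_bilinearComp hm' hs]
  exact congr(√(1 + $((key (covecOf p)).symm)))

lemma contDiffAt_sqrt_one_add_dual (g : RiemannianMetricOn n M)
    (hφ : φ ∈ IsManifold.maximalAtlas (𝓡 n) ∞ M) {z : Rn n × RnDual n} (hz : z.1 ∈ φ.target) :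
    ContDiffAt ℝ ∞ (fun w : Rn n × RnDual n ↦ √(1 + w.2 ((metricCoord g φ w.1).inverse w.2))) z := by
  have hm := isMetricForm_metricCoord g hφ hz
  have h1 : ContDiffAt ℝ ∞ (fun w : Rn n × RnDual n ↦ (metricCoord g φ w.1).inverse) z :=
    ContDiffAt.comp z (f := Prod.fst) (g := fun u ↦ (metricCoord g φ u).inverse)
      ((contDiffOn_inverse (contDiffOn_metricCoord g hφ)
        fun u hu ↦ isMetricForm_metricCoord g hφ hu).contDiffAt (φ.open_target.mem_nhds hz))
      contDiffAt_fst
  refine (contDiffAt_const.add (contDiffAt_snd.clm_apply (h1.clm_apply contDiffAt_snd))).sqrt ?_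
  have := hm.dual_nonneg z.2
  positivity

lemma covecSize_eventuallyEq (g : RiemannianMetricOn n M)
    (hφ : φ ∈ IsManifold.maximalAtlas (𝓡 n) ∞ M) {p : CotangentBundle n M}
    (hp : p.1 ∈ φ.source) : covecSize g =ᶠ[𝓝 p]
      (fun w : Rn n × RnDual n ↦ √(1 + w.2 ((metricCoord g φ w.1).inverse w.2))) ∘ cotChart φ := by
  filter_upwards [eventually_proj_mem φ.open_source hp] with q hq
  exact covecSize_eq g hφ hq

lemma contMDiff_covecSize (g : RiemannianMetricOn n M) :
    ContMDiff (cotangentModel n) 𝓘(ℝ, ℝ) ∞ (covecSize g) := fun p ↦ by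
  have hφ : chartAt (Rn n) p.1 ∈ IsManifold.maximalAtlas (𝓡 n) ∞ M :=
    IsManifold.chart_mem_maximalAtlas _
  have hp := mem_chart_source (Rn n) p.1
  exact ((contDiffAt_sqrt_one_add_dual g hφ ((chartAt (Rn n) p.1).map_source
    hp)).contMDiffAt.comp p (contMDiffAt_cotChart hφ hp)).congr_of_eventuallyEq
      (covecSize_eventuallyEq g hφ hp)

lemma IsSasakianMetric.mfderiv_covecSize_sq_le {g : RiemannianMetricOn n M}
    {G : CotangentRiemannianMetric n M} (h : IsSasakianMetric g G) (p : CotangentBundle n M)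
    (v : TangentSpace (cotangentModel n) p) :
    realDiff (cotangentModel n) (covecSize g) p v ^ 2 ≤ G.inner p v v := by
  set φ := chartAt (Rn n) p.1
  have hφ : φ ∈ IsManifold.maximalAtlas (𝓡 n) ∞ M := IsManifold.chart_mem_maximalAtlas _
  have hp : p.1 ∈ φ.source := mem_chart_source (Rn n) p.1
  have hz : (cotChart φ p).1 ∈ φ.target := φ.map_source hp
  have h1 := HasMFDerivAt.comp p ((contDiffAt_sqrt_one_add_dual g hφ hz).differentiableAt
    (by simp)).hasFDerivAt.hasMFDerivAt (hasMFDerivAt_cotChart hφ hp)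
  rw [realDiff, (h1.congr_of_eventuallyEq (covecSize_eventuallyEq g hφ hp)).mfderiv]
  have h2 := fderiv_sqrt_one_add_dual_sq_le φ.open_target (contDiffOn_metricCoord g hφ)
    (fun u hu ↦ isMetricForm_metricCoord g hφ hu) hz (dcotChart φ p v)
  have h3 := congr($((isSasakianMetric_iff g G).1 h φ hφ p hp) v v)
  exact h2.trans h3.ge

lemma exists_isCompact_of_covecSize_le (g : RiemannianMetricOn n M) (R : ℝ) (x : M) :
    ∃ V ∈ 𝓝 x, ∃ K : Set (CotangentBundle n M), IsCompact K ∧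
      ∀ p : CotangentBundle n M, p.1 ∈ V → covecSize g p ≤ R → p ∈ K := by
  set φ := chartAt (Rn n) x
  have hφ : φ ∈ IsManifold.maximalAtlas (𝓡 n) ∞ M := IsManifold.chart_mem_maximalAtlas _
  have hx : x ∈ φ.source := mem_chart_source (Rn n) x
  obtain ⟨r, hr, hball⟩ := Metric.nhds_basis_closedBall.mem_iff.1
    (φ.open_target.mem_nhds (φ.map_source hx))
  obtain ⟨C, hC⟩ := (isCompact_closedBall (φ x) r).exists_bound_of_continuousOn
    ((contDiffOn_metricCoord g hφ).continuousOn.mono hball)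
  refine ⟨φ.source ∩ φ ⁻¹' Metric.closedBall (φ x) r, inter_mem (φ.open_source.mem_nhds hx)
    ((φ.continuousAt hx).preimage_mem_nhds (Metric.closedBall_mem_nhds _ hr)),
    cotChartSymm φ '' (Metric.closedBall (φ x) r ×ˢ Metric.closedBall 0 √(R ^ 2 * C)),
    ((isCompact_closedBall _ _).prod (isCompact_closedBall _ _)).image_of_continuousOn
      fun z hz ↦ (contMDiffAt_cotChartSymm hφ (hball hz.1)).continuousAt.continuousWithinAt,
    fun p hp hR ↦ ⟨cotChart φ p, ⟨hp.2, ?_⟩, cotChartSymm_cotChart hφ hp.1⟩⟩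
  have hm := isMetricForm_metricCoord g hφ (φ.map_source hp.1)
  have h0 := hm.dual_nonneg (cotChart φ p).2
  have h1 := hm.norm_sq_le (cotChart φ p).2
  rw [mem_closedBall_zero_iff]
  refine Real.le_sqrt_of_sq_le (h1.trans ?_)
  have h2 : (cotChart φ p).2 ((metricCoord g φ (φ p.1)).inverse (cotChart φ p).2) ≤ R ^ 2 := by
    rw [covecSize_eq g hφ hp.1] at hR
    have h3 := pow_le_pow_left₀ (Real.sqrt_nonneg _) hR 2
    rw [Real.sq_sqrt (by positivity)] at h3
    change 1 + (cotChart φ p).2 ((metricCoord g φ (φ p.1)).inverse (cotChart φ p).2) ≤ R ^ 2 at h3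
    linarith
  exact mul_le_mul h2 (hC _ hp.2) (norm_nonneg _) (sq_nonneg R)

lemma exists_isCompact_covecSize_le [CompactSpace M] (g : RiemannianMetricOn n M) (R : ℝ) :
    ∃ K : Set (CotangentBundle n M), IsCompact K ∧ ∀ p, covecSize g p ≤ R → p ∈ K := by
  choose V hV K hK h using exists_isCompact_of_covecSize_le g R
  obtain ⟨t, ht⟩ := finite_cover_nhds hV
  refine ⟨⋃ x ∈ t, K x, t.isCompact_biUnion fun x _ ↦ hK x, fun p hp ↦ ?_⟩
  have : p.1 ∈ ⋃ x ∈ t, V x := by rw [ht]; trivial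
  obtain ⟨x, hx, hpx⟩ := Set.mem_iUnion₂.1 this
  exact Set.mem_iUnion₂.2 ⟨x, hx, h x p hpx hp⟩

lemma IsSasakianMetric.isCompleteMetric [CompactSpace M] {g : RiemannianMetricOn n M}
    {G : CotangentRiemannianMetric n M} (h : IsSasakianMetric g G) : IsCompleteMetric G := by
  intro p hp
  obtain ⟨N, hN⟩ := hp 1 one_pos
  obtain ⟨K, hK, hKp⟩ := exists_isCompact_covecSize_le g (covecSize g (p N) + 1)
  have hmem : ∀ᶠ k in atTop, p k ∈ K := by
    filter_upwards [eventually_ge_atTop N] with k hk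
    refine hKp _ ?_
    have h1 := (edist_le_cotDist G ((contMDiff_covecSize g).of_le (by simp))
      h.mfderiv_covecSize_sq_le (p k) (p N)).trans (hN k hk N le_rfl).le
    rw [edist_dist, ENNReal.ofReal_le_one, Real.dist_eq] at h1
    linarith [(abs_le.1 h1).2]
  obtain ⟨q, -, hq⟩ := hK.exists_mapClusterPt (le_principal_iff.2 hmem)
  refine ⟨q, ENNReal.tendsto_nhds_zero.2 fun ε hε ↦ ?_⟩
  obtain ⟨N', hN'⟩ := hp (ε / 2) (ENNReal.half_pos hε.ne')
  obtain ⟨l, hl, hlN⟩ := ((hq.frequently (eventually_cotDist_lt G q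
    (ENNReal.half_pos hε.ne'))).and_eventually (eventually_ge_atTop N')).exists
  filter_upwards [eventually_ge_atTop N'] with k hk
  calc cotDist G (p k) q ≤ cotDist G (p k) (p l) + cotDist G (p l) q := cotDist_triangle G _ _ _
    _ ≤ ε / 2 + ε / 2 := by
      gcongr
      · exact (hN' k hk l hlN).le
      · rw [cotDist_comm]; exact hl.le
    _ = ε := ENNReal.add_halves ε

end Completeness

end SasakiCotangent

theorem mainTheorem6 (n : ℕ) (M : Type*) [TopologicalSpace M] [T2Space M] [CompactSpace M]
    [ChartedSpace (SasakiCotangent.Rn n) M] [IsManifold (𝓡 n) ∞ M]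
    (g : SasakiCotangent.RiemannianMetricOn n M) :
    (∃! G : SasakiCotangent.CotangentRiemannianMetric n M,
      SasakiCotangent.IsSasakianMetric g G) ∧
    ∀ G : SasakiCotangent.CotangentRiemannianMetric n M,
      SasakiCotangent.IsSasakianMetric g G → SasakiCotangent.IsCompleteMetric G := by
  exact ⟨⟨SasakiCotangent.sasakiMetric g, SasakiCotangent.isSasakianMetric_sasakiMetric g,
    fun _ h ↦ h.eq (SasakiCotangent.isSasakianMetric_sasakiMetric g)⟩,
    fun _ h ↦ h.isCompleteMetric⟩
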